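/- Let $k$ be an odd positive integer and let $\chi$ be a non-principal primitive Dirichlet character modulo $k$, with complex conjugate $\bar\chi$ and Gauss sum $G(\chi)=\sum_{v=0}^{k-1}\chi(v)e^{2\pi i v/k}$. For $\operatorname{Im} z>0$, $s\in\mathbb{C}$ and a Dirichlet character $\psi$ modulo $k$ put $$H_1(z,s:\psi)=(1+e^{\pi i s})\sum_{n=1}^{\infty}\sum_{m=1}^{\infty}(-1)^m\psi(m)\psi(n)n^{s-1}e^{2\pi i mnz/k},$$ $$B_1(z,s:\psi)=(1+e^{\pi i s})\sum_{n=0}^{\infty}\sum_{m=1}^{\infty}\psi(m)\psi(2n+1)(2n+1)^{s-1}e^{\pi i m(2n+1)z/k}.$$ Let $\mathfrak{B}_m$ be the Bernoulli function (period $1$, equal to the Bernoulli polynomial $B_m(x)$ for $0\le x<1$, except that $\mathfrak{B}_1$ vanishes at the integers). Let $\mathcal{E}_m$ be the Euler function (equal to the Euler polynomial $E_m(x)$ for $0\le x<1$, with $\mathcal{E}_m(x+1)=-\mathcal{E}_m(x)$), and let $$\mathcal{E}_{m,\psi}(x)=k^m\sum_{j=0}^{k-1}(-1)^j\bar\psi(j)\,\mathcal{E}_m\!\left(\frac{j+x}{k}\right).$$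 For integers $c>0$, $d$ and $p\ge1$ put $$g_1(c,d,z,p,\psi)=\sum_{m=1}^{p}\binom{p}{m}k^{m-p}\bigl(-(cz+d)\bigr)^{m-1}\sum_{n=1}^{ck}\psi(n)\,\mathcal{E}_{p-m,\psi}\!\left(\frac{dn}{c}\right)\mathfrak{B}_m\!\left(\frac{n}{ck}\right).$$ Theorem. Let $p\ge1$ be odd, and let $a,b,c,d$ be integers with $ad-bc=1$, $c>0$, and $c$, $d$ odd. Let $Rz=\dfrac{az+b+ak}{cz+d+ck}$. Then for $\psi\in\{\chi,\bar\chi\}$ and $z\in\mathbb{C}$ $$g_1(c,d+ck,z,p,\psi)=\sum_{m=1}^{p}\binom{p}{m}k^{m-p}\bigl(-(cz+d+ck)\bigr)^{m-1}\sum_{n=1}^{ck}(-1)^n\psi(n)\,\mathcal{E}_{p-m,\psi}\!\left(\frac{dn}{c}\right)\mathfrak{B}_m\!\left(\frac{n}{ck}\right).$$ If $a\equiv d\equiv0\pmod k$, then for all $z$ with $\operatorname{Im} z>0$ $$G(\bar\chi)(cz+d+ck)^{p-1}H_1(Rz,1-p:\chi)=\bar\chi(b)\chi(c)G(\chi)2^p\chi(2)B_1(z,1-p:\bar\chi)-\frac{\bar\chi(b)\chi(-c)}{2}\,\frac{(2\pi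 i)^p}{p!}\,g_1(c,d+ck,z,p,\bar\chi).$$ If $b\equiv c\equiv0\pmod k$, then for all $z$ with $\operatorname{Im} z>0$ $$G(\bar\chi)(cz+d+ck)^{p-1}H_1(Rz,1-p:\chi)=\bar\chi(a)\chi(d)G(\bar\chi)2^p\bar\chi(2)B_1(z,1-p:\chi)-\frac{\bar\chi(a)\chi(-d)}{2}\,\frac{(2\pi i)^p}{p!}\,g_1(c,d+ck,z,p,\chi).$$ -/

import Mathlib

namespace CharLogTheta

noncomputable section

/-- The value `E_n(x)` of the `n`-th Euler polynomial, defined by the generating function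
`2 e^{xt} / (e^t + 1) = ∑ E_n(x) t^n / n!` (as formal power series in `t` over `ℝ`). -/
def eulerPolyFun (n : ℕ) (x : ℝ) : ℝ :=
  (n.factorial : ℝ) *
    PowerSeries.coeff n
      (2 * PowerSeries.rescale x (PowerSeries.exp ℝ) * (PowerSeries.exp ℝ + 1)⁻¹)

/-- The Bernoulli function `𝔅_n`: it has period one, equals `B_n(x)` on `[0, 1)`, except that
`𝔅_1` vanishes at the integers. -/
def bernoulliPer (n : ℕ) (x : ℝ) : ℝ :=
  if n = 1 ∧ Int.fract x = 0 then 0 else bernoulliFun n (Int.fract x)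

/-- The Euler function `ℰ_n`: it equals `E_n(x)` on `[0, 1)` and `ℰ_n(x + m) = (-1)^m ℰ_n(x)` for
every integer `m`. -/
def eulerPer (n : ℕ) (x : ℝ) : ℝ :=
  (-1 : ℝ) ^ ⌊x⌋ * eulerPolyFun n (Int.fract x)

/-- The character Euler function
`ℰ_{m,χ}(x) = k^m ∑_{j=0}^{k-1} (-1)^j χ̄(j) ℰ_m((j + x)/k)`. -/
def eulerChar {k : ℕ} (m : ℕ) (χ : DirichletCharacter ℂ k) (x : ℝ) : ℂ :=
  (k : ℂ) ^ m * ∑ j ∈ Finset.range k,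
    (-1 : ℂ) ^ j * (star χ) (j : ZMod k) * (eulerPer m (((j : ℝ) + x) / k) : ℂ)

/-- `A_1(z, s : χ) = ∑_{n ≥ 1} ∑_{m ≥ 1} (-1)^m χ(m) χ(n) n^{s-1} e^{2πimnz/k}`. -/
def A1 {k : ℕ} (z s : ℂ) (χ : DirichletCharacter ℂ k) : ℂ :=
  ∑' n : ℕ+, ∑' m : ℕ+,
    (-1 : ℂ) ^ (m : ℕ) * χ ((m : ℕ) : ZMod k) * χ ((n : ℕ) : ZMod k) *
      ((n : ℕ) : ℂ) ^ (s - 1) *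
      Complex.exp (2 * Real.pi * Complex.I * ((m : ℕ) : ℂ) * ((n : ℕ) : ℂ) * z / k)

/-- `H_1(z, s : χ) = (1 + e^{πis}) A_1(z, s : χ)`. -/
def H1 {k : ℕ} (z s : ℂ) (χ : DirichletCharacter ℂ k) : ℂ :=
  (1 + Complex.exp (Real.pi * Complex.I * s)) * A1 z s χ

/-- `B(z, s : χ) = ∑_{n ≥ 0} ∑_{m ≥ 1} χ(m) χ(2n+1) (2n+1)^{s-1} e^{πim(2n+1)z/k}`. -/
def B {k : ℕ} (z s : ℂ) (χ : DirichletCharacter ℂ k) : ℂ :=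
  ∑' n : ℕ, ∑' m : ℕ+,
    χ ((m : ℕ) : ZMod k) * χ ((2 * n + 1 : ℕ) : ZMod k) *
      ((2 * n + 1 : ℕ) : ℂ) ^ (s - 1) *
      Complex.exp (Real.pi * Complex.I * ((m : ℕ) : ℂ) * ((2 * n + 1 : ℕ) : ℂ) * z / k)

/-- `B_1(z, s : χ) = (1 + e^{πis}) B(z, s : χ)`. -/
def B1 {k : ℕ} (z s : ℂ) (χ : DirichletCharacter ℂ k) : ℂ :=
  (1 + Complex.exp (Real.pi * Complex.I * s)) * B z s χ

/-- `g_1(c, d, z, p, χ) = ∑_{m=1}^p C(p,m) k^{m-p} (-(cz+d))^{m-1}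
  ∑_{n=1}^{ck} χ(n) ℰ_{p-m,χ}(dn/c) 𝔅_m(n/(ck))`. -/
def g1 {k : ℕ} (c d : ℤ) (z : ℂ) (p : ℕ) (χ : DirichletCharacter ℂ k) : ℂ :=
  ∑ m ∈ Finset.Icc 1 p,
    (p.choose m : ℂ) * (k : ℂ) ^ ((m : ℤ) - (p : ℤ)) * (-((c : ℂ) * z + (d : ℂ))) ^ (m - 1) *
      ∑ n ∈ Finset.Icc (1 : ℤ) (c * (k : ℤ)),
        χ (n : ZMod k) * eulerChar (p - m) χ ((d : ℝ) * (n : ℝ) / (c : ℝ)) *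
          (bernoulliPer m ((n : ℝ) / ((c : ℝ) * (k : ℝ))) : ℂ)

/-- The Gauss sum `G(χ) = ∑_{v mod k} χ(v) e^{2πiv/k}`. -/
def G {k : ℕ} [NeZero k] (χ : DirichletCharacter ℂ k) : ℂ :=
  gaussSum χ (ZMod.stdAddChar (N := k))

/-- Auxiliary absolute convergence of the double series below. -/
theorem summable_aux (s w : ℂ) (hw : 0 < w.im) (f : ℕ+ × ℕ+ → ℂ) (hf : ∀ q, ‖f q‖ ≤ 1) :
    Summable fun q : ℕ+ × ℕ+ =>
      f q * ((q.1 : ℕ) : ℂ) ^ (s - 1) *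
        Complex.exp (2 * Real.pi * Complex.I * ((q.2 : ℕ) : ℂ) * ((q.1 : ℕ) : ℂ) * w) := by
  obtain ⟨K, hK⟩ := exists_nat_ge (s - 1).re
  have hr : ‖Complex.exp (2 * Real.pi * Complex.I * w)‖ < 1 := by
    rw [Complex.norm_exp, Real.exp_lt_one_iff]
    have : (2 * Real.pi * Complex.I * w).re = -(2 * Real.pi * w.im) := by simp
    rw [this]; have := Real.pi_pos; nlinarith [mul_pos this hw]
  refine Summable.of_norm_bounded (summable_prod_mul_pow K hr).prod_symm.norm fun q => ?_
  have hq : (1 : ℝ) ≤ ((q.1 : ℕ) : ℝ) := by exact_mod_cast q.1.pos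
  have h1 : ‖((q.1 : ℕ) : ℂ) ^ (s - 1)‖ ≤ ‖((q.1 : ℕ) : ℂ) ^ K‖ := by
    rw [Complex.norm_natCast_cpow_of_pos q.1.pos, norm_pow, Complex.norm_natCast]
    exact (Real.rpow_le_rpow_of_exponent_le hq hK).trans_eq (Real.rpow_natCast _ _)
  have h2 : Complex.exp (2 * Real.pi * Complex.I * ((q.2 : ℕ) : ℂ) * ((q.1 : ℕ) : ℂ) * w) =
      Complex.exp (2 * Real.pi * Complex.I * w) ^ ((q.2 : ℕ) * (q.1 : ℕ)) := by
    rw [← Complex.exp_nat_mul]; push_cast; ring_nf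
  rw [h2, norm_mul, norm_mul, norm_mul]
  have h3 := mul_le_mul (hf q) h1 (norm_nonneg _) zero_le_one
  rw [one_mul] at h3
  exact mul_le_mul_of_nonneg_right h3 (norm_nonneg _)

/-- The double series defining `A_1` converges absolutely in the upper half-plane. -/
theorem summable_A1 {k : ℕ} [NeZero k] (z s : ℂ) (hz : 0 < z.im) (χ : DirichletCharacter ℂ k) :
    Summable fun q : ℕ+ × ℕ+ =>
      (-1 : ℂ) ^ (q.2 : ℕ) * χ ((q.2 : ℕ) : ZMod k) * χ ((q.1 : ℕ) : ZMod k) *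
      ((q.1 : ℕ) : ℂ) ^ (s - 1) *
      Complex.exp (2 * Real.pi * Complex.I * ((q.2 : ℕ) : ℂ) * ((q.1 : ℕ) : ℂ) * z / k) := by
  have hk : (0 : ℝ) < k := by exact_mod_cast Nat.pos_of_neZero k
  have hw : 0 < (z / k).im := by
    rw [Complex.div_natCast_im]; positivity
  refine (summable_aux s (z / k) hw
    (fun q => (-1 : ℂ) ^ (q.2 : ℕ) * χ ((q.2 : ℕ) : ZMod k) * χ ((q.1 : ℕ) : ZMod k))
    fun q => ?_).congr fun q => by rw [mul_div_assoc]
  rw [norm_mul, norm_mul, norm_pow, norm_neg, norm_one, one_pow, one_mul]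
  exact mul_le_one₀ (χ.norm_le_one _) (norm_nonneg _) (χ.norm_le_one _)

/-- The double series defining `B` converges absolutely in the upper half-plane. -/
theorem summable_B {k : ℕ} [NeZero k] (z s : ℂ) (hz : 0 < z.im) (χ : DirichletCharacter ℂ k) :
    Summable fun q : ℕ × ℕ+ =>
      χ ((q.2 : ℕ) : ZMod k) * χ ((2 * q.1 + 1 : ℕ) : ZMod k) *
      ((2 * q.1 + 1 : ℕ) : ℂ) ^ (s - 1) *
      Complex.exp (Real.pi * Complex.I * ((q.2 : ℕ) : ℂ) * ((2 * q.1 + 1 : ℕ) : ℂ) * z / k) := by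
  have hk : (0 : ℝ) < k := by exact_mod_cast Nat.pos_of_neZero k
  have hw : 0 < (z / 2 / k).im := by
    rw [Complex.div_natCast_im, Complex.div_ofNat_im]; positivity
  have h := summable_aux s (z / 2 / k) hw
    (fun q => χ ((q.2 : ℕ) : ZMod k) * χ ((q.1 : ℕ) : ZMod k)) fun q => by
      rw [norm_mul]
      exact mul_le_one₀ (χ.norm_le_one _) (norm_nonneg _) (χ.norm_le_one _)
  have hi : Function.Injective fun q : ℕ × ℕ+ => (Nat.succPNat (2 * q.1), q.2) := by
    rintro ⟨n, m⟩ ⟨n', m'⟩ hq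
    simp only [Prod.mk.injEq, Nat.succPNat_inj] at hq ⊢
    exact ⟨by omega, hq.2⟩
  refine (h.comp_injective hi).congr fun q => ?_
  simp only [Function.comp_apply, Nat.succPNat_coe, Nat.succ_eq_add_one]
  congr 2
  ring

end

end CharLogTheta

namespace CharLogTheta

open Filter Topology Finset

/-! ### Symmetric sums over the integers -/

/-! Write `d + ck = 2δ`, `U = (cz + 2δ)/2`, and give the lattice point `(n, M)` with `M` odd and `n
= Mδ - cN` the weight `W(n, M) = ψ(M) ψ̄(N)`, where `ψ` is `χ̄` in the first congruence case and `χ`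
in the second. The formula compares the two orders of summation of a conditionally convergent double
series with these weights.

For fixed `M`, `MU - n = c(Mz/2 + N)`, so summing `W/(n - MU)` over `n` gives a character cotangent
sum at `-Mz/2`, whose Lambert expansion produces `B` at `z`. For fixed `n`, the unimodular
substitution `M = 2an + cl`, `N = b'n + δl`, with `b' = b + ak`, turns the weight into `κ χ(n)
χ̄(l)` with `l` odd (this is where the congruences enter). The sum over `M` is then a cotangent sum
at `k/2 + n·Rz`, which produces `A1` at `Rz`; the shift `k/2` is the source of the sign `(-1)^m`.

The partial fraction `pow_div_eq_partial_fraction` links `U^p / (n^p (MU - n))` to `1 / (M^p (MU -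
n))`, up to the terms `U^{m-1} / (M^{p+1-m} n^m)`. In `pow_mul_tsum_cotSum_eq` both iterated series
are limits over the same boxes, because mean-zero weights give uniform bounds
(`exists_norm_sum_div_le`) and dominated convergence applies. The leftover box sums factor once `W`
is expanded in additive characters (`sum_exp_eq_latticeWeight`). Their limits are products of
Bernoulli and Euler function values, and these add up to `g1` (`tendsto_sum_latticeWeight`,
`sum_pow_mul_dedekindSum_eq_g1`). `A1_transformation` assembles the pieces. -/

theorem sum_Ico_neg_eq (f : ℤ → ℂ) (N : ℕ) :
    ∑ h ∈ Ico (-(N : ℤ)) N, f h =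
      ∑ j ∈ range N, (f (-(j + 1)) + f (j + 1)) + f 0 - f N := by
  induction N with
  | zero => simp
  | succ N ih =>
    have h1 : ∑ h ∈ Ico (-((N + 1 : ℕ) : ℤ)) (N + 1 : ℕ), f h =
        f (-(N + 1)) + ∑ h ∈ Ico (-(N : ℤ)) N, f h + f N := by
      push_cast
      rw [← Finset.insert_Ico_right_eq_Ico_add_one (by omega), sum_insert (by simp),
        ← Finset.insert_Ico_add_one_left_eq_Ico (by omega), sum_insert (by simp)]
      rw [show -((N : ℤ) + 1) + 1 = -N by ring]
      ring
    rw [h1, ih, sum_range_succ]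
    push_cast
    ring

theorem tendsto_one_div_add_natCast (w : ℂ) :
    Tendsto (fun N : ℕ => 1 / (w + N)) atTop (𝓝 0) := by
  simp only [one_div]
  refine tendsto_inv₀_cobounded.comp ?_
  rw [← tendsto_norm_atTop_iff_cobounded]
  refine tendsto_atTop_mono (fun N : ℕ => (?_ : (N : ℝ) - ‖w‖ ≤ _)) ?_
  · have := norm_sub_norm_le (N : ℂ) (-w)
    rw [norm_neg, Complex.norm_natCast, sub_neg_eq_add, add_comm (N : ℂ)] at this
    exact this
  · exact tendsto_atTop_add_const_right _ _ tendsto_natCast_atTop_atTop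

/-- The partial fraction expansion of the cotangent, summed over symmetric intervals. -/
theorem tendsto_sum_Ico_cot {w : ℂ} (hw : w ∈ Complex.integerComplement) :
    Tendsto (fun N : ℕ => ∑ t ∈ Ico (-(N : ℤ)) N, 1 / (w + t)) atTop
      (𝓝 (Real.pi * Complex.cot (Real.pi * w))) := by
  -- The library series pairs `t` with `-t` for `t ≥ 1`. The term `t = 0` is added, and the term `t
  -- = N` removed since the interval is half-open.
  have h := ((tendsto_logDeriv_euler_cot_sub hw).add_const (1 / w)).sub
    (tendsto_one_div_add_natCast w)
  rw [sub_add_cancel, sub_zero] at h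
  refine h.congr fun N => ?_
  rw [sum_Ico_neg_eq]
  simp [cotTerm, sub_eq_add_neg]

/-! ### Fourier expansions of the Bernoulli functions -/

theorem tendsto_Ico_neg_atTop : Tendsto (fun N : ℕ => Ico (-(N : ℤ)) N) atTop atTop := by
  refine tendsto_atTop_finset_of_monotone (fun a b hab => ?_) fun x => ⟨x.natAbs + 1, ?_⟩
  · exact Ico_subset_Ico (by omega) (by omega)
  · rw [mem_Ico]; omega

theorem norm_sum_geom_le {q : ℂ} (hq : ‖q‖ = 1) (hq1 : q ≠ 1) (n : ℕ) :
    ‖∑ i ∈ range n, q ^ (i + 1)‖ ≤ 2 / ‖q - 1‖ := by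
  have h : ∑ i ∈ range n, q ^ (i + 1) = q * ((q ^ n - 1) / (q - 1)) := by
    rw [← geom_sum_eq hq1, mul_sum]
    exact sum_congr rfl fun i _ => by ring
  rw [h, norm_mul, hq, one_mul, norm_div]
  gcongr
  refine (norm_sub_le _ _).trans ?_
  rw [norm_pow, hq]; norm_num

/-- The logarithmic series on the unit circle. -/
theorem tendsto_sum_pow_div_log {q : ℂ} (hq : ‖q‖ = 1) (hq1 : q ≠ 1)
    (hs : 1 - q ∈ Complex.slitPlane) :
    Tendsto (fun N : ℕ => ∑ j ∈ range N, q ^ (j + 1) / ((j : ℂ) + 1)) atTop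
      (𝓝 (-Complex.log (1 - q))) := by
  -- Convergence is Dirichlet's test. Abel's limit theorem then identifies the limit `l` by letting
  -- `x → 1` from the left.
  have hc : CauchySeq fun N : ℕ => ∑ j ∈ range N, (1 / ((j : ℝ) + 1)) • q ^ (j + 1) :=
    Antitone.cauchySeq_series_mul_of_tendsto_zero_of_bounded
      (fun a b hab => by
        have : (a : ℝ) ≤ b := by exact_mod_cast hab
        exact one_div_le_one_div_of_le (by positivity) (by linarith))
      tendsto_one_div_add_atTop_nhds_zero_nat (norm_sum_geom_le hq hq1)
  have hc' : ∀ N : ℕ, ∑ j ∈ range N, (1 / ((j : ℝ) + 1)) • q ^ (j + 1) =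
      ∑ j ∈ range N, q ^ (j + 1) / ((j : ℂ) + 1) := fun N => sum_congr rfl fun j _ => by
    rw [Complex.real_smul]; push_cast; ring
  simp only [hc'] at hc
  obtain ⟨l, hl⟩ := cauchySeq_tendsto_of_complete hc
  have ha := Complex.tendsto_tsum_powerSeries_nhdsWithin_lt hl
  rw [tendsto_map'_iff] at ha
  have hcont : Tendsto (fun x : ℝ => -Complex.log (1 - x * q)) (𝓝[<] 1)
      (𝓝 (-Complex.log (1 - q))) := by
    have : ContinuousAt (fun x : ℝ => -Complex.log (1 - x * q)) 1 := by
      refine ContinuousAt.neg (ContinuousAt.clog (by fun_prop) ?_)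
      simpa using hs
    have h2 := this.tendsto.mono_left (nhdsWithin_le_nhds (s := Set.Iio 1))
    simpa using h2
  have hev : ∀ᶠ x : ℝ in 𝓝[<] 1, 0 < x ∧ x < 1 := by
    filter_upwards [Ioo_mem_nhdsLT (zero_lt_one' ℝ)] with x hx using hx
  -- The extra factor `x` raises `x ^ n` to `x ^ (n + 1)`, matching the Taylor series of `-log (1 -
  -- xq)`.
  have hlim : Tendsto (fun x : ℝ => (x : ℂ) * ∑' n : ℕ, q ^ (n + 1) / ((n : ℂ) + 1) * (x : ℂ) ^ n)
      (𝓝[<] 1) (𝓝 (1 * l)) := by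
    refine Tendsto.mul ?_ ha
    have : Tendsto (fun x : ℝ => (x : ℂ)) (𝓝 1) (𝓝 ((1 : ℝ) : ℂ)) :=
      Complex.continuous_ofReal.tendsto 1
    simpa using this.mono_left nhdsWithin_le_nhds
  rw [one_mul] at hlim
  have hfin : l = -Complex.log (1 - q) := by
    refine tendsto_nhds_unique hlim (hcont.congr' ?_)
    filter_upwards [hev] with x hx
    have hn : ‖(x : ℂ) * q‖ < 1 := by
      rw [norm_mul, hq, Complex.norm_real, Real.norm_of_nonneg hx.1.le]; linarith [hx.2]
    have h1 := Complex.hasSum_taylorSeries_neg_log hn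
    rw [← hasSum_nat_add_iff' 1] at h1
    simp only [range_one, sum_singleton, pow_zero, Nat.cast_zero, div_zero, sub_zero] at h1
    rw [← h1.tsum_eq, ← tsum_mul_left]
    refine tsum_congr fun n => ?_
    push_cast
    rw [mul_pow]; ring
  exact hfin ▸ hl

/-- Both numbers have modulus `2 sin(πx)` and arguments `±π(x - 1/2)`, which lie in `(-π/2, π/2)`.
So the principal logarithms are read off from the polar forms and the moduli cancel. -/
theorem log_one_sub_exp_sub {x : ℝ} (h0 : 0 < x) (h1 : x < 1) :
    1 - Complex.exp (2 * Real.pi * Complex.I * x) ∈ Complex.slitPlane ∧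
    1 - Complex.exp (-(2 * Real.pi * Complex.I * x)) ∈ Complex.slitPlane ∧
    Complex.log (1 - Complex.exp (2 * Real.pi * Complex.I * x)) -
      Complex.log (1 - Complex.exp (-(2 * Real.pi * Complex.I * x))) =
      2 * Real.pi * Complex.I * (x - 1 / 2) := by
  have hs : 0 < 2 * Real.sin (Real.pi * x) := by
    have := Real.sin_pos_of_pos_of_lt_pi (x := Real.pi * x) (by positivity)
      (by nlinarith [Real.pi_pos])
    positivity
  have hr : ∀ y : ℝ, 1 - Complex.exp (2 * Real.pi * Complex.I * y) =
      (2 * Real.sin (Real.pi * y) : ℝ) * (Complex.exp ((Real.pi * (y - 1 / 2) : ℝ) * Complex.I)) := by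
    intro y
    have e1 : Complex.exp ((Real.pi * (y - 1 / 2) : ℝ) * Complex.I) =
        Complex.exp (Real.pi * y * Complex.I) * (-Complex.I) := by
      rw [← Complex.exp_neg_pi_div_two_mul_I, ← Complex.exp_add]
      congr 1; push_cast; ring
    have e2 : Complex.exp (2 * Real.pi * Complex.I * y) =
        Complex.exp (Real.pi * y * Complex.I) * Complex.exp (Real.pi * y * Complex.I) := by
      rw [← Complex.exp_add]; congr 1; ring
    have e3 : Complex.exp (-(Real.pi * y) * Complex.I) * Complex.exp (Real.pi * y * Complex.I) = 1 := by
      rw [← Complex.exp_add, ← Complex.exp_zero]; congr 1; ring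
    rw [e1, e2]
    push_cast
    rw [Complex.sin]
    linear_combination (-1 : ℂ) * e3 +
      (Complex.exp (-(Real.pi * y) * Complex.I) * Complex.exp (Real.pi * y * Complex.I) -
        Complex.exp (Real.pi * y * Complex.I) ^ 2) * Complex.I_sq
  have hr' : 1 - Complex.exp (-(2 * Real.pi * Complex.I * x)) =
      (2 * Real.sin (Real.pi * x) : ℝ) * (Complex.exp ((-(Real.pi * (x - 1 / 2)) : ℝ) * Complex.I)) := by
    have h := hr (1 - x)
    have e : Complex.exp (2 * Real.pi * Complex.I * ((1 - x : ℝ) : ℂ)) =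
        Complex.exp (-(2 * Real.pi * Complex.I * x)) := by
      have : 2 * Real.pi * Complex.I * ((1 - x : ℝ) : ℂ) =
        -(2 * Real.pi * Complex.I * x) + 2 * Real.pi * Complex.I := by push_cast; ring
      rw [this, Complex.exp_add, Complex.exp_two_pi_mul_I, mul_one]
    rw [e] at h
    rw [h]
    congr 2
    · rw [show Real.pi * (1 - x) = Real.pi - Real.pi * x by ring, Real.sin_pi_sub]
    · congr 2; ring
  have hlog : ∀ t : ℝ, |t| < Real.pi / 2 → 
      (2 * Real.sin (Real.pi * x) : ℝ) * (Complex.exp ((t : ℝ) * Complex.I)) ∈ Complex.slitPlane ∧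
      Complex.log ((2 * Real.sin (Real.pi * x) : ℝ) * (Complex.exp ((t : ℝ) * Complex.I))) =
        Real.log (2 * Real.sin (Real.pi * x)) + t * Complex.I := by
    intro t ht
    rw [abs_lt] at ht
    have hpi := Real.pi_pos
    constructor
    · rw [Complex.mem_slitPlane_iff]
      left
      rw [Complex.re_ofReal_mul, Complex.exp_ofReal_mul_I_re]
      exact mul_pos hs (Real.cos_pos_of_mem_Ioo ⟨by linarith [ht.1], ht.2⟩)
    · rw [Complex.log_ofReal_mul hs (Complex.exp_ne_zero _), Complex.log_exp] <;>
      simp <;> linarith [ht.1, ht.2]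
  have hx : |Real.pi * (x - 1 / 2)| < Real.pi / 2 := by
    rw [abs_lt]; constructor <;> nlinarith [Real.pi_pos]
  have hA := hlog _ hx
  have hB := hlog (-(Real.pi * (x - 1 / 2))) (by rwa [abs_neg])
  rw [hr x, hr']
  refine ⟨hA.1, hB.1, ?_⟩
  rw [hA.2, hB.2]
  push_cast; ring

theorem exp_fract (h : ℤ) (x : ℝ) :
    Complex.exp (2 * Real.pi * Complex.I * h * x) =
      Complex.exp (2 * Real.pi * Complex.I * h * (Int.fract x : ℝ)) := by
  rw [Complex.exp_eq_exp_iff_exists_int]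
  refine ⟨h * ⌊x⌋, ?_⟩
  rw [← Int.self_sub_floor]
  push_cast; ring

/-- The Fourier expansion of the Bernoulli functions, at every real point. -/
theorem tendsto_sum_Ico_bernoulliPer {m : ℕ} (hm : 1 ≤ m) (x : ℝ) :
    Tendsto (fun N : ℕ => ∑ h ∈ Ico (-(N : ℤ)) N,
        Complex.exp (2 * Real.pi * Complex.I * h * x) / (h : ℂ) ^ m) atTop
      (𝓝 (-(2 * Real.pi * Complex.I) ^ m / (m.factorial : ℂ) * (bernoulliPer m x : ℂ))) := by
  simp only [fun h => exp_fract h x]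
  have hf0 := Int.fract_nonneg x
  have hf1 := Int.fract_lt_one x
  -- Only `m = 1` is conditionally convergent. There the terms `h` and `-h` are paired: at integers
  -- they cancel, elsewhere they give a difference of two logarithmic series. The unpaired endpoint
  -- tends to `0`.
  rcases eq_or_lt_of_le hm with rfl | hm
  · simp only [pow_one, Nat.factorial_one, Nat.cast_one, div_one, bernoulliPer, true_and]
    simp only [sum_Ico_neg_eq]
    by_cases hx : Int.fract x = 0
    · simp only [hx, if_true]
      have h := tendsto_one_div_add_natCast 0
      refine (h.neg.congr fun N => ?_).trans (by simp)
      have h0 : ∀ j : ℕ, (-1 + -(j : ℂ))⁻¹ + ((j : ℂ) + 1)⁻¹ = 0 := fun j => by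
        rw [show (-1 + -(j : ℂ)) = -((j : ℂ) + 1) by ring, inv_neg, neg_add_cancel]
      simp [h0]
    · have hx0 : 0 < Int.fract x := lt_of_le_of_ne hf0 (Ne.symm hx)
      obtain ⟨hs1, hs2, hlog⟩ := log_one_sub_exp_sub hx0 hf1
      simp only [hx, if_false]
      set y := Int.fract x
      have hn1 : ‖Complex.exp (2 * Real.pi * Complex.I * y)‖ = 1 := by
        rw [show (2 * Real.pi * Complex.I * y : ℂ) = ((2 * Real.pi * y : ℝ) : ℂ) * Complex.I by
          push_cast; ring]
        exact Complex.norm_exp_ofReal_mul_I _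
      have hn2 : ‖Complex.exp (-(2 * Real.pi * Complex.I * y))‖ = 1 := by
        rw [Complex.exp_neg, norm_inv, hn1, inv_one]
      have hne1 : Complex.exp (2 * Real.pi * Complex.I * y) ≠ 1 := by
        intro h; rw [h, sub_self] at hs1; exact Complex.zero_notMem_slitPlane hs1
      have hne2 : Complex.exp (-(2 * Real.pi * Complex.I * y)) ≠ 1 := by
        intro h; rw [h, sub_self] at hs2; exact Complex.zero_notMem_slitPlane hs2
      have hT1 := tendsto_sum_pow_div_log hn1 hne1 hs1
      have hT2 := tendsto_sum_pow_div_log hn2 hne2 hs2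
      have hT3 : Tendsto (fun N : ℕ => Complex.exp (2 * Real.pi * Complex.I * (N : ℤ) * y) /
          ((N : ℤ) : ℂ)) atTop (𝓝 0) := by
        rw [tendsto_zero_iff_norm_tendsto_zero]
        have := (tendsto_one_div_add_natCast 0).norm
        rw [norm_zero] at this
        refine this.congr fun N => ?_
        rw [norm_div, norm_div, show (2 * Real.pi * Complex.I * (N : ℤ) * y : ℂ) =
          ((N : ℕ) : ℂ) * (2 * Real.pi * Complex.I * y) by push_cast; ring, Complex.exp_nat_mul,
          norm_pow, hn1]
        simp
      have hT := (hT1.sub hT2).sub hT3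
      have hval : -Complex.log (1 - Complex.exp (2 * Real.pi * Complex.I * y)) -
          -Complex.log (1 - Complex.exp (-(2 * Real.pi * Complex.I * y))) - 0 =
          -(2 * Real.pi * Complex.I) * (bernoulliFun 1 y : ℝ) := by
        rw [bernoulliFun_one]
        push_cast
        linear_combination -hlog
      rw [hval] at hT
      refine hT.congr fun N => ?_
      rw [← sum_sub_distrib]
      simp only [Int.cast_zero, div_zero, add_zero]
      congr 1
      refine sum_congr rfl fun j _ => ?_
      rw [← Complex.exp_nat_mul, ← Complex.exp_nat_mul]
      push_cast
      rw [show (2 * Real.pi * Complex.I * -((j : ℂ) + 1) * y : ℂ) =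
        ((j : ℂ) + 1) * -(2 * Real.pi * Complex.I * y) by ring,
        show (2 * Real.pi * Complex.I * ((j : ℂ) + 1) * y : ℂ) =
        ((j : ℂ) + 1) * (2 * Real.pi * Complex.I * y) by ring, div_neg]
      ring
  · have h := hasSum_one_div_pow_mul_fourier_mul_bernoulliFun (k := m) hm ⟨hf0, hf1.le⟩
    have h' := h.comp tendsto_Ico_neg_atTop
    have hb : bernoulliPer m x = bernoulliFun m (Int.fract x) := by
      rw [bernoulliPer, if_neg (by omega)]
    rw [hb]
    refine h'.congr fun N => ?_
    refine sum_congr rfl fun n _ => ?_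
    simp only [fourier_coe_apply, Complex.ofReal_one, div_one]
    ring

/-! ### Euler functions -/

/-- The exponential generating function of the values of the Bernoulli polynomials at `x`. -/
noncomputable def bernoulliSeries (x : ℝ) : PowerSeries ℝ :=
  PowerSeries.mk fun n => bernoulliFun n x / n.factorial

theorem bernoulliSeries_mul_exp_sub_one (x : ℝ) :
    bernoulliSeries x * (PowerSeries.exp ℝ - 1) =
      PowerSeries.X * PowerSeries.rescale x (PowerSeries.exp ℝ) := by
  rw [← Polynomial.bernoulli_generating_function, bernoulliSeries]
  congr 2
  ext n
  rw [map_smul, bernoulliFun, Polynomial.aeval_def, Polynomial.eval_map, Algebra.smul_def]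
  simp only [one_div, map_inv₀, map_natCast]
  ring

theorem rescale_exp_mul_rescale_exp (a b : ℝ) :
    PowerSeries.rescale a (PowerSeries.exp ℝ) * PowerSeries.rescale b (PowerSeries.exp ℝ) =
      PowerSeries.rescale (a + b) (PowerSeries.exp ℝ) :=
  PowerSeries.exp_mul_exp_eq_exp_add a b

/-- The Euler polynomials in terms of the Bernoulli polynomials. -/
theorem eulerPolyFun_eq (q : ℕ) (x : ℝ) :
    eulerPolyFun q x = 2 ^ (q + 1) / (q + 1) *
      (bernoulliFun (q + 1) ((x + 1) / 2) - bernoulliFun (q + 1) (x / 2)) := by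
  have hE : PowerSeries.constantCoeff (PowerSeries.exp ℝ + 1) ≠ 0 := by simp
  have hE0 : PowerSeries.exp ℝ - 1 ≠ 0 := by
    intro h
    have := congrArg (PowerSeries.coeff 1) h
    simp [PowerSeries.coeff_exp, PowerSeries.coeff_one] at this
  have h2 : PowerSeries.rescale (2 : ℝ) (PowerSeries.exp ℝ) = PowerSeries.exp ℝ ^ 2 := by
    have := rescale_exp_mul_rescale_exp 1 1
    rw [PowerSeries.rescale_one, RingHom.id_apply, one_add_one_eq_two] at this
    rw [← this, sq]
  have hb : ∀ y : ℝ, PowerSeries.rescale (2 : ℝ) (bernoulliSeries y) * (PowerSeries.exp ℝ ^ 2 - 1) =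
      2 * PowerSeries.X * PowerSeries.rescale (2 * y) (PowerSeries.exp ℝ) := by
    intro y
    have := congrArg (PowerSeries.rescale (2 : ℝ)) (bernoulliSeries_mul_exp_sub_one y)
    rw [map_mul, map_mul, map_sub, map_one, h2, PowerSeries.rescale_rescale,
      PowerSeries.rescale_X] at this
    rw [this, mul_comm y 2]
    congr 2
  have hE' := PowerSeries.mul_inv_cancel _ hE
  -- Replacing `t` by `2t` gives `2t e^{2yt} / (e^{2t} - 1)`. At `y = (x+1)/2` and `y = x/2` the
  -- difference has numerator `2t e^{xt} (e^t - 1)`, and `e^{2t} - 1 = (e^t - 1)(e^t + 1)`.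
  have key : PowerSeries.rescale (2 : ℝ) (bernoulliSeries ((x + 1) / 2)) -
      PowerSeries.rescale (2 : ℝ) (bernoulliSeries (x / 2)) =
      PowerSeries.X * (2 * PowerSeries.rescale x (PowerSeries.exp ℝ) *
        (PowerSeries.exp ℝ + 1)⁻¹) := by
    have hne : PowerSeries.exp ℝ + 1 ≠ 0 := fun h => hE (by rw [h, map_zero])
    apply mul_right_cancel₀ (mul_ne_zero hne hE0)
    have hx1 := hb ((x + 1) / 2)
    have hx2 := hb (x / 2)
    rw [mul_div_cancel₀ _ two_ne_zero] at hx1 hx2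
    have hx3 := rescale_exp_mul_rescale_exp x 1
    rw [PowerSeries.rescale_one, RingHom.id_apply] at hx3
    rw [← hx3] at hx1
    linear_combination hx1 - hx2 - 2 * PowerSeries.X *
      PowerSeries.rescale x (PowerSeries.exp ℝ) * (PowerSeries.exp ℝ - 1) * hE'
  have hc := congrArg (PowerSeries.coeff (q + 1)) key
  rw [PowerSeries.coeff_succ_X_mul, map_sub, PowerSeries.coeff_rescale, PowerSeries.coeff_rescale,
    bernoulliSeries, bernoulliSeries, PowerSeries.coeff_mk, PowerSeries.coeff_mk] at hc
  rw [eulerPolyFun, ← hc, Nat.factorial_succ]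
  have : (q.factorial : ℝ) ≠ 0 := by positivity
  push_cast
  field_simp

theorem eulerPer_add_intCast (q : ℕ) (x : ℝ) (n : ℤ) :
    eulerPer q (x + n) = (-1) ^ n * eulerPer q x := by
  rw [eulerPer, eulerPer, Int.floor_add_intCast, Int.fract_add_intCast,
    zpow_add₀ (by norm_num : (-1 : ℝ) ≠ 0)]
  ring

theorem bernoulliPer_add_intCast (m : ℕ) (x : ℝ) (n : ℤ) :
    bernoulliPer m (x + n) = bernoulliPer m x := by
  rw [bernoulliPer, bernoulliPer, Int.fract_add_intCast]

/-- On `[0, 1)` this is the polynomial identity. Shifting `x` by `1` exchanges the two Bernoulli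
terms up to an integer translation, which is the sign rule of `ℰ`. For `q = 0` at an integer it
fails: the right side is `0`, whereas `ℰ_0` is `±1`. -/
theorem eulerPer_eq_bernoulliPer {q : ℕ} {x : ℝ} (h : q = 0 → Int.fract x ≠ 0) :
    eulerPer q x = 2 ^ (q + 1) / (q + 1) *
      (bernoulliPer (q + 1) ((x + 1) / 2) - bernoulliPer (q + 1) (x / 2)) := by
  have hf0 := Int.fract_nonneg x
  have hf1 := Int.fract_lt_one x
  set y := Int.fract x with hy
  have hxy : x = y + (⌊x⌋ : ℤ) := by rw [hy, Int.fract_add_floor]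
  have hsmall : ∀ z : ℝ, 0 ≤ z → z < 1 → (q = 0 → z ≠ 0) →
      bernoulliPer (q + 1) z = bernoulliFun (q + 1) z := by
    intro z h0 h1 hz
    have : Int.fract z = z := Int.fract_eq_self.2 ⟨h0, h1⟩
    rw [bernoulliPer, this, if_neg]
    rintro ⟨h2, h3⟩
    exact hz (by omega) h3
  have hB1 := hsmall (y / 2) (by linarith) (by linarith) (fun hq => by
    have := h hq
    simpa using this)
  have hB2 := hsmall ((y + 1) / 2) (by linarith) (by linarith) (fun hq => by
    intro h0; linarith)
  have hE : eulerPer q x = (-1) ^ ⌊x⌋ * eulerPolyFun q y := rfl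
  rw [hE, eulerPolyFun_eq, ← hB1, ← hB2, hxy]
  rcases Int.even_or_odd' ⌊x⌋ with ⟨n, hn | hn⟩
  · rw [← hxy, hn, Even.neg_one_zpow (even_two_mul n), one_mul]
    rw [show x / 2 = y / 2 + (n : ℤ) by rw [hxy, hn]; push_cast; ring,
      show (x + 1) / 2 = (y + 1) / 2 + (n : ℤ) by rw [hxy, hn]; push_cast; ring,
      bernoulliPer_add_intCast, bernoulliPer_add_intCast]
  · rw [← hxy, hn, Odd.neg_one_zpow (odd_two_mul_add_one n)]
    rw [show x / 2 = (y + 1) / 2 + (n : ℤ) by rw [hxy, hn]; push_cast; ring,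
      show (x + 1) / 2 = y / 2 + ((n + 1 : ℤ) : ℝ) by rw [hxy, hn]; push_cast; ring,
      bernoulliPer_add_intCast, bernoulliPer_add_intCast]
    ring

theorem exp_pi_mul_I_mul_intCast (h : ℤ) :
    Complex.exp (Real.pi * Complex.I * h) = if Odd h then -1 else 1 := by
  rw [mul_comm, Complex.exp_int_mul, Complex.exp_pi_mul_I]
  split_ifs with ho
  · exact ho.neg_one_zpow
  · exact (Int.not_odd_iff_even.1 ho).neg_one_zpow

/-- The Fourier expansion of the Euler functions. -/
theorem tendsto_sum_Ico_eulerPer {q : ℕ} {x : ℝ} (h : q = 0 → Int.fract x ≠ 0) :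
    Tendsto (fun N : ℕ => ∑ M ∈ Ico (-(N : ℤ)) N,
        (if Odd M then Complex.exp (Real.pi * Complex.I * M * x) / (M : ℂ) ^ (q + 1) else 0)) atTop
      (𝓝 ((Real.pi * Complex.I) ^ (q + 1) / (2 * (q.factorial : ℂ)) * (eulerPer q x : ℂ))) := by
  have h1 := tendsto_sum_Ico_bernoulliPer (m := q + 1) (by omega) (x / 2)
  have h2 := tendsto_sum_Ico_bernoulliPer (m := q + 1) (by omega) ((x + 1) / 2)
  -- The expansions at `x/2` and `(x+1)/2` differ by the factor `(-1)^M`, so half their difference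
  -- keeps exactly the odd frequencies.
  have h3 := (h1.sub h2).const_mul (1 / 2)
  have hval : (Real.pi * Complex.I) ^ (q + 1) / (2 * (q.factorial : ℂ)) * (eulerPer q x : ℂ) =
      1 / 2 * (-(2 * Real.pi * Complex.I) ^ (q + 1) / ((q + 1).factorial : ℂ) *
        (bernoulliPer (q + 1) (x / 2) : ℂ) - -(2 * Real.pi * Complex.I) ^ (q + 1) /
          ((q + 1).factorial : ℂ) * (bernoulliPer (q + 1) ((x + 1) / 2) : ℂ)) := by
    rw [eulerPer_eq_bernoulliPer h, Nat.factorial_succ]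
    have e1 : (q.factorial : ℂ) ≠ 0 := by exact_mod_cast q.factorial_ne_zero
    have e2 : (q : ℂ) + 1 ≠ 0 := by exact_mod_cast q.succ_ne_zero
    push_cast
    field_simp
    ring
  rw [hval]
  refine h3.congr fun N => ?_
  rw [← sum_sub_distrib, mul_sum]
  refine sum_congr rfl fun M _ => ?_
  have e1 : Complex.exp (2 * Real.pi * Complex.I * M * ((x / 2 : ℝ) : ℂ)) =
      Complex.exp (Real.pi * Complex.I * M * x) := by
    congr 1; push_cast; ring
  have e2 : Complex.exp (2 * Real.pi * Complex.I * M * (((x + 1) / 2 : ℝ) : ℂ)) =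
      Complex.exp (Real.pi * Complex.I * M * x) * Complex.exp (Real.pi * Complex.I * M) := by
    rw [← Complex.exp_add]
    congr 1; push_cast; ring
  rw [e1, e2, exp_pi_mul_I_mul_intCast]
  split_ifs <;> ring

/-! ### Lattice sums with periodic weights -/

/-- The half-open interval of length `2KT` consists of complete blocks of residues modulo `K`, so
periodic weights can be handled block by block without boundary terms. -/
theorem sum_Ico_mul_eq_sum_blocks {K : ℕ} (hK : 0 < K) (f : ℤ → ℂ) (T : ℕ) :
    ∑ r ∈ Ico (-((K * T : ℕ) : ℤ)) (K * T : ℕ), f r =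
      ∑ t ∈ Ico (-(T : ℤ)) T, ∑ i ∈ range K, f (i + K * t) := by
  have hK' : (0 : ℤ) < K := by exact_mod_cast hK
  rw [← sum_product']
  symm
  refine sum_nbij' (fun x => (x.2 : ℤ) + K * x.1) (fun r => (r / K, (r % K).toNat)) ?_ ?_ ?_ ?_ ?_
  · rintro ⟨t, i⟩ h
    simp only [mem_product, mem_Ico, mem_range] at h ⊢
    obtain ⟨⟨h1, h2⟩, h3⟩ := h
    have h3' : (i : ℤ) < K := by exact_mod_cast h3
    push_cast
    constructor <;> nlinarith
  · intro r h
    simp only [mem_product, mem_Ico, mem_range] at h ⊢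
    push_cast at h
    have h1 := Int.emod_nonneg r hK'.ne'
    have h2 := Int.emod_lt_of_pos r hK'
    refine ⟨⟨?_, ?_⟩, by omega⟩
    · rw [Int.le_ediv_iff_mul_le hK']; linarith [h.1, mul_comm (K : ℤ) T]
    · rw [Int.ediv_lt_iff_lt_mul hK']; linarith [h.2, mul_comm (K : ℤ) T]
  · rintro ⟨t, i⟩ h
    simp only [mem_product, mem_Ico, mem_range] at h
    have h3' : (i : ℤ) < K := by exact_mod_cast h.2
    have e1 : ((i : ℤ) + K * t) / K = t := by
      rw [Int.add_mul_ediv_left _ _ hK'.ne', Int.ediv_eq_zero_of_lt (by positivity) h3', zero_add]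
    have e2 : ((i : ℤ) + K * t) % K = i := by
      rw [Int.add_mul_emod_self_left, Int.emod_eq_of_lt (by positivity) h3']
    simp only [e1, e2, Int.toNat_natCast]
  · intro r h
    simp only
    rw [Int.toNat_of_nonneg (Int.emod_nonneg r hK'.ne'), Int.emod_add_mul_ediv]
  · intro x h
    rfl

theorem mem_integerComplement_of_im_ne_zero {w : ℂ} (hw : w.im ≠ 0) :
    w ∈ Complex.integerComplement := by
  rintro ⟨n, rfl⟩
  simp at hw

/-- The imaginary part controls `|q|`, and then the triangle inequality controls `|r|`. -/
theorem exists_mul_abs_add_abs_le_norm {τ : ℂ} (hτ : τ.im ≠ 0) :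
    ∃ η : ℝ, 0 < η ∧ ∀ q r : ℤ, η * (|(r : ℝ)| + |(q : ℝ)|) ≤ ‖(r : ℂ) + q * τ‖ := by
  have hy : 0 < |τ.im| := abs_pos.2 hτ
  refine ⟨|τ.im| / (|τ.im| + ‖τ‖ + 1), by positivity, fun q r => ?_⟩
  have h1 : |(q : ℝ)| * |τ.im| ≤ ‖(r : ℂ) + q * τ‖ := by
    have := Complex.abs_im_le_norm ((r : ℂ) + q * τ)
    simpa [abs_mul] using this
  have h2 : |(r : ℝ)| ≤ ‖(r : ℂ) + q * τ‖ + |(q : ℝ)| * ‖τ‖ := by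
    have := norm_sub_le ((r : ℂ) + q * τ) (q * τ)
    rw [add_sub_cancel_right, norm_mul, Complex.norm_intCast, Complex.norm_intCast] at this
    exact this
  rw [div_mul_eq_mul_div, div_le_iff₀ (by positivity)]
  nlinarith [norm_nonneg τ, mul_le_mul_of_nonneg_left h2 hy.le,
    mul_le_mul_of_nonneg_left h1 (norm_nonneg τ)]

theorem summable_one_div_one_add_abs_rpow :
    Summable fun t : ℤ => 1 / (1 + |(t : ℝ)|) ^ (3 / 2 : ℝ) := by
  refine Summable.of_nonneg_of_le (fun t => by positivity) (fun t => ?_)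
    ((Real.summable_one_div_int_add_rpow (1 / 2) (3 / 2)).2 (by norm_num))
  have h0 : 0 < |(t : ℝ) + 1 / 2| := by
    rw [abs_pos]
    intro h
    have : (2 * t + 1 : ℤ) = 0 := by
      have : ((2 * t + 1 : ℤ) : ℝ) = 0 := by push_cast; linarith
      exact_mod_cast this
    omega
  refine one_div_le_one_div_of_le (by positivity) ?_
  refine Real.rpow_le_rpow h0.le ?_ (by norm_num)
  refine (abs_add_le _ _).trans ?_
  rw [abs_of_pos (by norm_num : (0 : ℝ) < 1 / 2)]; linarith

/-- A truncated weighted sum of `1 / (r + qτ)` with mean zero weights. -/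
theorem exists_norm_sum_div_le {K : ℕ} (hK : 0 < K) {τ : ℂ} (hτ : τ.im ≠ 0) {w : ℤ → ℤ → ℂ} {C : ℝ}
    (hC : ∀ q r, ‖w q r‖ ≤ C) (hper : ∀ q r t, w q (r + K * t) = w q r)
    (hmean : ∀ q, ∑ i ∈ range K, w q i = 0) :
    ∃ D : ℝ, 0 ≤ D ∧ ∀ q : ℤ, q ≠ 0 → ∀ T : ℕ,
      ‖∑ r ∈ Ico (-((K * T : ℕ) : ℤ)) (K * T : ℕ), w q r / (r + q * τ)‖ ≤
        D / |(q : ℝ)| ^ (1 / 2 : ℝ) := by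
  obtain ⟨η, hη, hle⟩ := exists_mul_abs_add_abs_le_norm hτ
  have hC0 : 0 ≤ C := (norm_nonneg _).trans (hC 0 0)
  set E : ℝ := K * (C * (2 * K / η ^ 2)) with hE
  have hE0 : 0 ≤ E := by positivity
  refine ⟨E * ∑' t : ℤ, 1 / (1 + |(t : ℝ)|) ^ (3 / 2 : ℝ), by positivity, fun q hq T => ?_⟩
  have hq1 : (1 : ℝ) ≤ |(q : ℝ)| := by exact_mod_cast Int.one_le_abs hq
  rw [sum_Ico_mul_eq_sum_blocks hK]
  have hblock : ∀ t : ℤ, ‖∑ i ∈ range K, w q (i + K * t) / (((i + K * t : ℤ) : ℂ) + q * τ)‖ ≤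
      E / |(q : ℝ)| ^ (1 / 2 : ℝ) * (1 / (1 + |(t : ℝ)|) ^ (3 / 2 : ℝ)) := by
    intro t
    -- As the weights have mean zero, the common value `1 / (Kt + qτ)` may be subtracted throughout
    -- the block. Each difference is then `O((|t| + |q|)^{-2})`.
    have hsub : ∑ i ∈ range K, w q (i + K * t) / (((i + K * t : ℤ) : ℂ) + q * τ) =
        ∑ i ∈ range K, w q i * (1 / (((i + K * t : ℤ) : ℂ) + q * τ) -
          1 / (((K * t : ℤ) : ℂ) + q * τ)) := by
      have : ∑ i ∈ range K, w q i * (1 / (((K * t : ℤ) : ℂ) + q * τ)) = 0 := by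
        rw [← sum_mul, hmean, zero_mul]
      rw [← sub_zero (∑ i ∈ range K, w q (i + K * t) / (((i + K * t : ℤ) : ℂ) + q * τ)), ← this,
        ← sum_sub_distrib]
      refine sum_congr rfl fun i _ => ?_
      rw [hper]; ring
    set s : ℝ := |(t : ℝ)| + |(q : ℝ)| with hs
    have hs1 : 1 ≤ s := by linarith [abs_nonneg (t : ℝ)]
    have hK1 : (1 : ℝ) ≤ K := by exact_mod_cast hK
    have hterm : ∀ i ∈ range K, ‖w q i * (1 / (((i + K * t : ℤ) : ℂ) + q * τ) -
          1 / (((K * t : ℤ) : ℂ) + q * τ))‖ ≤ C * (2 * K / η ^ 2) * (1 / s ^ 2) := by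
      intro i hi
      have hi' : (i : ℝ) ≤ K := by exact_mod_cast (mem_range.1 hi).le
      have ha : η * s ≤ ‖((K * t : ℤ) : ℂ) + q * τ‖ := by
        refine le_trans ?_ (hle q (K * t))
        have : |(t : ℝ)| ≤ |((K * t : ℤ) : ℝ)| := by
          push_cast; rw [abs_mul, Nat.abs_cast]; nlinarith [abs_nonneg (t : ℝ)]
        rw [hs]
        gcongr
      -- The offset `i < K` costs at most `1` in `|t|`, and `|q| ≥ 1` absorbs it at the price of the
      -- factor `1/2`.
      have hb : η * s / 2 ≤ ‖((i + K * t : ℤ) : ℂ) + q * τ‖ := by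
        refine le_trans ?_ (hle q (i + K * t))
        have h2 : |(t : ℝ)| ≤ |((i + K * t : ℤ) : ℝ)| + 1 := by
          have h3 : |(K * t : ℝ)| ≤ |((i + K * t : ℤ) : ℝ)| + i := by
            have := abs_sub ((i + K * t : ℤ) : ℝ) i
            rw [Nat.abs_cast] at this
            push_cast at this ⊢
            rwa [add_sub_cancel_left] at this
          rw [abs_mul, Nat.abs_cast] at h3
          by_contra hcon
          push Not at hcon
          nlinarith [abs_nonneg (((i + K * t : ℤ) : ℝ))]
        rw [mul_div_assoc]
        gcongr
        linarith [abs_nonneg (((i + K * t : ℤ) : ℝ))]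
      have hηs : 0 < η * s := by positivity
      have ha0 : ((K * t : ℤ) : ℂ) + q * τ ≠ 0 := norm_pos_iff.1 (hηs.trans_le ha)
      have hb0 : ((i + K * t : ℤ) : ℂ) + q * τ ≠ 0 :=
        norm_pos_iff.1 (lt_of_lt_of_le (by positivity) hb)
      rw [norm_mul, mul_assoc]
      refine mul_le_mul (hC _ _) ?_ (norm_nonneg _) hC0
      rw [div_sub_div _ _ hb0 ha0, norm_div, norm_mul]
      have hnum : 1 * (((K * t : ℤ) : ℂ) + q * τ) - (((i + K * t : ℤ) : ℂ) + q * τ) * 1 = -(i : ℂ) := by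
        push_cast; ring
      rw [hnum, norm_neg, Complex.norm_natCast, div_mul_div_comm, mul_one]
      have hden : η ^ 2 * s ^ 2 / 2 ≤ ‖((i + K * t : ℤ) : ℂ) + q * τ‖ * ‖((K * t : ℤ) : ℂ) + q * τ‖ := by
        calc η ^ 2 * s ^ 2 / 2 = (η * s / 2) * (η * s) := by ring
          _ ≤ _ := mul_le_mul hb ha (by positivity) (norm_nonneg _)
      calc (i : ℝ) / _ ≤ K / (η ^ 2 * s ^ 2 / 2) := by gcongr
        _ = 2 * K / (η ^ 2 * s ^ 2) := by field_simp
    rw [hsub]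
    refine (norm_sum_le_of_le _ hterm).trans ?_
    rw [sum_const, card_range, nsmul_eq_mul]
    -- The exponent `2` is split as `1/2 + 3/2`: the second part makes the sum over `t` converge,
    -- and the first leaves a decay in `q` that makes the outer series converge even for `p = 1`.
    have hpow : |(q : ℝ)| ^ (1 / 2 : ℝ) * (1 + |(t : ℝ)|) ^ (3 / 2 : ℝ) ≤ s ^ 2 := by
      have : s ^ 2 = s ^ (1 / 2 : ℝ) * s ^ (3 / 2 : ℝ) := by
        rw [← Real.rpow_add (by positivity), ← Real.rpow_natCast]; norm_num
      rw [this]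
      gcongr
      · linarith [abs_nonneg (t : ℝ)]
      · linarith
    calc (K : ℝ) * (C * (2 * K / η ^ 2) * (1 / s ^ 2)) = E * (1 / s ^ 2) := by rw [hE]; ring
      _ ≤ E * (1 / (|(q : ℝ)| ^ (1 / 2 : ℝ) * (1 + |(t : ℝ)|) ^ (3 / 2 : ℝ))) := by gcongr
      _ = _ := by field_simp
  refine (norm_sum_le_of_le _ fun t _ => hblock t).trans ?_
  rw [← mul_sum, div_mul_eq_mul_div]
  have hsum := summable_one_div_one_add_abs_rpow.sum_le_tsum (Ico (-(T : ℤ)) T)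
    (fun t _ => by positivity)
  gcongr

/-- The symmetric sum of `w(q, r) / (r + qτ)` over `r`, for weights of period `K` in `r`. -/
noncomputable def cotSum (K : ℕ) (τ : ℂ) (w : ℤ → ℤ → ℂ) (q : ℤ) : ℂ :=
  ∑ i ∈ range K, w q i * (Real.pi / K * Complex.cot (Real.pi * ((i + q * τ) / K)))

/-- Each residue class modulo `K` contributes a cotangent expansion at `(i + qτ)/K`, which is not
real because `q ≠ 0`. -/
theorem tendsto_sum_Ico_cotSum {K : ℕ} (hK : 0 < K) {τ : ℂ} (hτ : τ.im ≠ 0) {w : ℤ → ℤ → ℂ}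
    (hper : ∀ q r t, w q (r + K * t) = w q r) {q : ℤ} (hq : q ≠ 0) :
    Tendsto (fun T : ℕ => ∑ r ∈ Ico (-((K * T : ℕ) : ℤ)) (K * T : ℕ), w q r / (r + q * τ)) atTop
      (𝓝 (cotSum K τ w q)) := by
  have hK0 : (K : ℂ) ≠ 0 := by exact_mod_cast hK.ne'
  simp only [sum_Ico_mul_eq_sum_blocks hK]
  have hlim : Tendsto (fun T : ℕ => ∑ i ∈ range K, w q i *
      (1 / K * ∑ t ∈ Ico (-(T : ℤ)) T, 1 / ((i + q * τ) / K + t))) atTop (𝓝 (cotSum K τ w q)) := by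
    refine tendsto_finsetSum _ fun i _ => Tendsto.const_mul _ ?_
    have hw : ((i + q * τ) / K) ∈ Complex.integerComplement := by
      refine mem_integerComplement_of_im_ne_zero ?_
      rw [Complex.div_natCast_im]
      simp [hτ, hq, hK.ne']
    have := (tendsto_sum_Ico_cot hw).const_mul (1 / (K : ℂ))
    rwa [← mul_assoc, one_div_mul_eq_div] at this
  refine hlim.congr fun T => ?_
  rw [sum_comm]
  refine sum_congr rfl fun i _ => ?_
  rw [mul_sum, mul_sum]
  refine sum_congr rfl fun t _ => ?_
  rw [hper, div_add' _ _ _ hK0, one_div_div, ← mul_div_assoc, one_div_mul_cancel hK0]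
  push_cast
  rw [← mul_div_assoc, mul_one]
  congr 1; ring

/-- Summability of the iterated sum, and its approximation by sums over boxes. -/
theorem summable_and_tendsto_cotSum {K : ℕ} (hK : 0 < K) {p : ℕ} (hp : 1 ≤ p) {τ : ℂ}
    (hτ : τ.im ≠ 0) {w : ℤ → ℤ → ℂ} {C : ℝ} (hC : ∀ q r, ‖w q r‖ ≤ C)
    (hper : ∀ q r t, w q (r + K * t) = w q r) (hmean : ∀ q, ∑ i ∈ range K, w q i = 0)
    {A : ℕ → Finset ℤ} (hA : Tendsto A atTop atTop) :
    (Summable fun q : ℤ => 1 / (q : ℂ) ^ p * cotSum K τ w q) ∧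
    Tendsto (fun T : ℕ => ∑ q ∈ A T, 1 / (q : ℂ) ^ p *
        ∑ r ∈ Ico (-((K * T : ℕ) : ℤ)) (K * T : ℕ), w q r / (r + q * τ)) atTop
      (𝓝 (∑' q : ℤ, 1 / (q : ℂ) ^ p * cotSum K τ w q)) := by
  obtain ⟨D, hD0, hD⟩ := exists_norm_sum_div_le hK hτ hC hper hmean
  have hsum : Summable fun q : ℤ => D * (1 / |(q : ℝ) + 0| ^ (3 / 2 : ℝ)) :=
    ((Real.summable_one_div_int_add_rpow 0 (3 / 2)).2 (by norm_num)).mul_left D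
  have hp0 : p ≠ 0 := by omega
  have hbound : ∀ (q : ℤ) (x : ℂ), (q ≠ 0 → ‖x‖ ≤ D / |(q : ℝ)| ^ (1 / 2 : ℝ)) →
      ‖1 / (q : ℂ) ^ p * x‖ ≤ D * (1 / |(q : ℝ) + 0| ^ (3 / 2 : ℝ)) := by
    intro q x hx
    -- The term at `q = 0` is zero by the convention `1 / 0 = 0`, since `p ≥ 1`.
    by_cases hq : q = 0
    · subst hq
      simp [hp0]
    · have hq1 : (1 : ℝ) ≤ |(q : ℝ)| := by exact_mod_cast Int.one_le_abs hq
      rw [norm_mul, norm_div, norm_one, norm_pow, Complex.norm_intCast, add_zero]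
      have e : |(q : ℝ)| ^ (3 / 2 : ℝ) = |(q : ℝ)| * |(q : ℝ)| ^ (1 / 2 : ℝ) := by
        rw [← Real.rpow_one_add' (by positivity) (by norm_num)]; norm_num
      rw [e]
      calc 1 / |(q : ℝ)| ^ p * ‖x‖ ≤ 1 / |(q : ℝ)| * (D / |(q : ℝ)| ^ (1 / 2 : ℝ)) := by
            gcongr
            · exact le_self_pow₀ hq1 hp0
            · exact hx hq
        _ = _ := by field_simp
  constructor
  · refine Summable.of_norm_bounded hsum fun q => hbound q _ fun hq => ?_
    exact le_of_tendsto (tendsto_sum_Ico_cotSum hK hτ hper hq).norm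
      (Eventually.of_forall fun T => hD q hq T)
  -- The bound is uniform in `T`, so the outer truncation and the inner limit can be taken
  -- simultaneously.
  · have := tendsto_tsum_of_dominated_convergence (𝓕 := atTop) (β := ℤ)
      (f := fun T q => if q ∈ A T then 1 / (q : ℂ) ^ p *
        ∑ r ∈ Ico (-((K * T : ℕ) : ℤ)) (K * T : ℕ), w q r / (r + q * τ) else 0)
      (g := fun q => 1 / (q : ℂ) ^ p * cotSum K τ w q) hsum ?_ ?_
    · refine this.congr fun T => ?_
      rw [tsum_eq_sum (s := A T) fun q hq => if_neg hq]
      exact sum_congr rfl fun q hq => if_pos hq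
    · intro q
      by_cases hq : q = 0
      · subst hq
        simp [hp0]
      · refine ((tendsto_sum_Ico_cotSum hK hτ hper hq).const_mul (1 / (q : ℂ) ^ p)).congr' ?_
        filter_upwards [hA.eventually_ge_atTop {q}] with T hT
        rw [if_pos (hT (mem_singleton_self q))]
    · refine Eventually.of_forall fun T q => ?_
      split_ifs
      · exact hbound q _ fun hq => hD q hq T
      · rw [norm_zero]; positivity

/-! ### Partial fractions and interchange of the order of summation. -/

/-- This is the factorization of `(U/n)^p - (1/M)^p` by `U/n - 1/M = (MU - n)/(nM)`. -/
theorem pow_div_eq_partial_fraction {U n M : ℂ} (hn : n ≠ 0) (hM : M ≠ 0) (hX : M * U - n ≠ 0)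
    (p : ℕ) :
    U ^ p * (1 / n ^ p * (1 / (M * U - n))) = 1 / M ^ p * (1 / (M * U - n)) +
      ∑ m ∈ Icc 1 p, U ^ (m - 1) * (1 / (M ^ (p + 1 - m) * n ^ m)) := by
  have h := geom_sum₂_mul (U / n) (1 / M) p
  have hsub : U / n - 1 / M = (M * U - n) / (n * M) := by field_simp
  have hsum : ∑ m ∈ Icc 1 p, U ^ (m - 1) * (1 / (M ^ (p + 1 - m) * n ^ m)) =
      (∑ i ∈ range p, (U / n) ^ i * (1 / M) ^ (p - 1 - i)) * (1 / (n * M)) := by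
    rw [sum_mul, range_eq_Ico, sum_Ico_eq_sum_range, ← Finset.Ico_add_one_right_eq_Icc,
      sum_Ico_eq_sum_range]
    refine sum_congr (by simp) fun i hi => ?_
    have hi' : i < p := by simpa using hi
    rw [show 1 + i - 1 = i by omega, show p + 1 - (1 + i) = (p - 1 - i) + 1 by omega, zero_add,
      div_pow, div_pow, one_pow, add_comm 1 i, pow_succ, pow_succ]
    field_simp
  rw [hsum]
  rw [hsub, div_pow, div_pow, one_pow] at h
  have h' : (∑ i ∈ range p, (U / n) ^ i * (1 / M) ^ (p - 1 - i)) * (1 / (n * M)) =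
      (U ^ p / n ^ p - 1 / M ^ p) * (1 / (M * U - n)) := by
    rw [← h, mul_assoc]
    congr 1
    field_simp
  rw [h']
  ring

theorem tendsto_mul_const_Ico {K : ℕ} (hK : 0 < K) :
    Tendsto (fun T : ℕ => Ico (-((K * T : ℕ) : ℤ)) (K * T : ℕ)) atTop atTop :=
  tendsto_Ico_neg_atTop.comp (tendsto_id.const_mul_atTop' hK)

/-- Interchanging the order of summation in a conditionally convergent double series: the
difference of the two iterated sums is given by the limits of `∑ W(n, M) M^{m-p-1} n^{-m}`. -/
theorem pow_mul_tsum_cotSum_eq {K₁ K₂ : ℕ} (hK₁ : 0 < K₁) (hK₂ : 0 < K₂) {p : ℕ} (hp : 1 ≤ p)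
    {U : ℂ} (hU : U.im ≠ 0) {W : ℤ → ℤ → ℂ} {C : ℝ} (hC : ∀ n M, ‖W n M‖ ≤ C)
    (hper₁ : ∀ n M t, W (n + K₁ * t) M = W n M) (hper₂ : ∀ n M t, W n (M + K₂ * t) = W n M)
    (hmean₁ : ∀ M, ∑ i ∈ range K₁, W i M = 0) (hmean₂ : ∀ n, ∑ i ∈ range K₂, W n i = 0)
    (h0₁ : ∀ M, W 0 M = 0) (h0₂ : ∀ n, W n 0 = 0) {L : ℕ → ℂ}
    (hL : ∀ m ∈ Icc 1 p, Tendsto (fun T : ℕ => ∑ n ∈ Ico (-((K₁ * T : ℕ) : ℤ)) (K₁ * T : ℕ),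
      ∑ M ∈ Ico (-((K₂ * T : ℕ) : ℤ)) (K₂ * T : ℕ),
        W n M * (1 / ((M : ℂ) ^ (p + 1 - m) * (n : ℂ) ^ m))) atTop (𝓝 (L m))) :
    U ^ p * (U⁻¹ * ∑' n : ℤ, 1 / (n : ℂ) ^ p * cotSum K₂ (-U⁻¹) W n) =
      -(∑' M : ℤ, 1 / (M : ℂ) ^ p * cotSum K₁ (-U) (fun M n => W n M) M) +
        ∑ m ∈ Icc 1 p, U ^ (m - 1) * L m := by
  have hU0 : U ≠ 0 := fun h => hU (by rw [h, Complex.zero_im])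
  have hUi : (-U⁻¹).im ≠ 0 := by
    rw [Complex.neg_im, Complex.inv_im, neg_div, neg_neg]
    exact div_ne_zero hU (by simpa using hU0)
  have hUn : (-U).im ≠ 0 := by simpa using hU
  have hA := (summable_and_tendsto_cotSum hK₂ hp hUi hC hper₂ hmean₂
    (tendsto_mul_const_Ico hK₁)).2
  have hB := (summable_and_tendsto_cotSum hK₁ hp hUn (w := fun M n => W n M) (fun q r => hC r q)
    (fun q r t => hper₁ r q t) hmean₁ (tendsto_mul_const_Ico hK₂)).2
  have hR := hB.neg.add (tendsto_finsetSum (Icc 1 p) fun m hm => (hL m hm).const_mul (U ^ (m - 1)))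
  -- Both sides are limits of the same finite box sums, so only a termwise identity remains. On the
  -- axes the weight vanishes; elsewhere it is the partial fraction.
  refine tendsto_nhds_unique ((hA.const_mul U⁻¹).const_mul (U ^ p)) (hR.congr fun T => ?_)
  have hX : ∀ n M : ℤ, M ≠ 0 → (M : ℂ) * U - n ≠ 0 := by
    intro n M hM h
    have := congrArg Complex.im h
    simp [hU, hM] at this
  simp only [mul_sum]
  rw [sum_comm, ← sum_neg_distrib, sum_comm (s := Icc 1 p), ← sum_add_distrib]
  · refine sum_congr rfl fun n _ => ?_
    rw [← sum_neg_distrib, sum_comm (s := Icc 1 p), ← sum_add_distrib]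
    refine sum_congr rfl fun M _ => ?_
    by_cases hn : n = 0
    · subst hn; simp [h0₁]
    by_cases hM : M = 0
    · subst hM; simp [h0₂]
    have hn' : (n : ℂ) ≠ 0 := by exact_mod_cast hn
    have hM' : (M : ℂ) ≠ 0 := by exact_mod_cast hM
    have h := pow_div_eq_partial_fraction hn' hM' (hX n M hM) p
    have e1 : U⁻¹ * (W n M / (M + n * -U⁻¹)) = W n M * (1 / (M * U - n)) := by
      rw [show (M : ℂ) + n * -U⁻¹ = (M * U - n) / U by field_simp; ring]
      field_simp
    have e2 : W n M / (n + M * -U) = -(W n M * (1 / (M * U - n))) := by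
      rw [show (n : ℂ) + M * -U = -(M * U - n) by ring, div_neg, mul_one_div]
    rw [e2]
    symm
    calc U ^ p * (U⁻¹ * (1 / (n : ℂ) ^ p * (W n M / (M + n * -U⁻¹)))) =
        U ^ p * (1 / (n : ℂ) ^ p * (U⁻¹ * (W n M / (M + n * -U⁻¹)))) := by ring
      _ = W n M * (U ^ p * (1 / (n : ℂ) ^ p * (1 / (M * U - n)))) := by rw [e1]; ring
      _ = _ := by
        rw [h, mul_add, mul_sum]
        congr 1
        · ring
        · exact sum_congr rfl fun m _ => by ring

/-! ### Sums of periodic functions over residue systems -/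

theorem sum_range_natCast_zmod (k : ℕ) [NeZero k] (F : ZMod k → ℂ) :
    ∑ i ∈ range k, F (i : ZMod k) = ∑ x : ZMod k, F x := by
  refine sum_nbij' (fun i => (i : ZMod k)) ZMod.val ?_ ?_ ?_ ?_ ?_
  · intro i _; exact mem_univ _
  · intro x _; exact mem_range.2 (ZMod.val_lt x)
  · intro i hi; exact ZMod.val_cast_of_lt (mem_range.1 hi)
  · intro x _; exact ZMod.natCast_zmod_val x
  · intro i _; rfl

theorem exists_zmod_eq_of_periodic {K : ℕ} [NeZero K] {h : ℤ → ℂ} (hh : ∀ x t, h (x + K * t) = h x) :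
    ∃ F : ZMod K → ℂ, ∀ x : ℤ, h x = F x := by
  refine ⟨fun y => h y.val, fun x => ?_⟩
  have h1 : ((x : ZMod K).val : ℤ) = x % K := ZMod.val_intCast x
  dsimp only
  rw [h1, ← hh (x % K) (x / K), Int.emod_add_mul_ediv]

theorem sum_range_add_of_periodic {K : ℕ} (hK : 0 < K) {h : ℤ → ℂ}
    (hh : ∀ x t, h (x + K * t) = h x) (x₀ : ℤ) :
    ∑ i ∈ range K, h (x₀ + i) = ∑ i ∈ range K, h i := by
  have : NeZero K := ⟨hK.ne'⟩
  obtain ⟨F, hF⟩ := exists_zmod_eq_of_periodic hh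
  simp only [hF, Int.cast_add, Int.cast_natCast]
  rw [sum_range_natCast_zmod K fun y => F (x₀ + y), sum_range_natCast_zmod K F]
  exact Equiv.sum_comp (Equiv.addLeft (x₀ : ZMod K)) F

theorem sum_range_neg_of_periodic {K : ℕ} (hK : 0 < K) {h : ℤ → ℂ}
    (hh : ∀ x t, h (x + K * t) = h x) :
    ∑ i ∈ range K, h (-i) = ∑ i ∈ range K, h i := by
  have : NeZero K := ⟨hK.ne'⟩
  obtain ⟨F, hF⟩ := exists_zmod_eq_of_periodic hh
  simp only [hF, Int.cast_neg, Int.cast_natCast]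
  rw [sum_range_natCast_zmod K fun y => F (-y), sum_range_natCast_zmod K F]
  exact Equiv.sum_comp (Equiv.neg (ZMod K)) F

/-- The sum of a periodic function supported on one residue class modulo `c`. -/
theorem sum_range_mul_of_periodic {c K : ℕ} (hc : 0 < c) (hK : 0 < K) {h : ℤ → ℂ}
    (hh : ∀ x t, h (x + (c * K : ℕ) * t) = h x) {x₀ : ℤ} (h0 : ∀ x, ¬ (c : ℤ) ∣ x - x₀ → h x = 0) :
    ∑ i ∈ range (c * K), h i = ∑ j ∈ range K, h (x₀ + c * j) := by
  rw [← sum_range_add_of_periodic (by positivity) hh x₀]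
  have hsub : ∑ j ∈ range K, h (x₀ + c * j) =
      ∑ i ∈ (range K).image (c * ·), h (x₀ + i) := by
    rw [sum_image fun a _ b _ hab => Nat.eq_of_mul_eq_mul_left hc hab]
    simp
  rw [hsub]
  symm
  refine sum_subset ?_ ?_
  · intro i hi
    obtain ⟨j, hj, rfl⟩ := mem_image.1 hi
    exact mem_range.2 (Nat.mul_lt_mul_of_pos_left (mem_range.1 hj) hc)
  · intro i hi hni
    refine h0 _ fun hdvd => hni ?_
    rw [add_sub_cancel_left, Int.natCast_dvd_natCast] at hdvd
    obtain ⟨j, rfl⟩ := hdvd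
    exact mem_image.2 ⟨j, mem_range.2 (Nat.lt_of_mul_lt_mul_left (mem_range.1 hi)), rfl⟩

/-- The odd classes modulo `2k` are listed as `k + 2j` rather than `1 + 2j`, so that a character
modulo `k` sees only `2j`. -/
theorem sum_range_two_mul_odd {k : ℕ} (hk : Odd k) {h : ℤ → ℂ}
    (hh : ∀ x t, h (x + (2 * k : ℕ) * t) = h x) (h0 : ∀ x, ¬ Odd x → h x = 0) :
    ∑ i ∈ range (2 * k), h i = ∑ j ∈ range k, h (k + 2 * j) := by
  have := sum_range_mul_of_periodic two_pos hk.pos hh (x₀ := k) fun x hx => h0 x fun ho => hx ?_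
  · exact_mod_cast this
  · have hk' : Odd (k : ℤ) := by exact_mod_cast hk
    exact (ho.sub_odd hk').two_dvd

/-! ### Cotangent sums with characters -/

theorem char_periodic {k : ℕ} (φ : DirichletCharacter ℂ k) (x t : ℤ) :
    φ ((x + k * t : ℤ) : ZMod k) = φ (x : ZMod k) := by
  simp

theorem char_zero {k : ℕ} {φ : DirichletCharacter ℂ k} (hφ : φ ≠ 1) : φ 0 = 0 := by
  refine MulChar.map_nonunit _ fun h => hφ ?_
  rw [isUnit_zero_iff] at h
  ext x
  have hx : (x : ZMod k) = 1 := by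
    calc (x : ZMod k) = x * 1 := (mul_one _).symm
      _ = x * 0 := by rw [h]
      _ = 1 := by rw [mul_zero, h]
  rw [hx, map_one, map_one]

section

variable {k : ℕ} [NeZero k]

/-- `∑_{j mod k} φ(j) (π / k) cot(π (j + w) / k)`, that is, the symmetric sum of `φ(j) / (j + w)`. -/
noncomputable def charCot (φ : DirichletCharacter ℂ k) (w : ℂ) : ℂ :=
  ∑ j ∈ range k, φ (j : ZMod k) * (Real.pi / k * Complex.cot (Real.pi * ((j + w) / k)))

theorem cot_pi_mul_add_intCast (z : ℂ) (t : ℤ) :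
    Complex.cot (Real.pi * (z + t)) = Complex.cot (Real.pi * z) := by
  rw [Complex.cot_pi_eq_exp_ratio, Complex.cot_pi_eq_exp_ratio, mul_add, Complex.exp_add,
    mul_comm (2 * Real.pi * Complex.I : ℂ) t, Complex.exp_int_mul_two_pi_mul_I, mul_one]

theorem cot_periodic {K : ℕ} (hK : 0 < K) (w : ℂ) (x t : ℤ) :
    Complex.cot (Real.pi * ((((x + K * t : ℤ) : ℂ) + w) / K)) =
      Complex.cot (Real.pi * (((x : ℂ) + w) / K)) := by
  have hK0 : (K : ℂ) ≠ 0 := by exact_mod_cast hK.ne'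
  rw [← cot_pi_mul_add_intCast (((x : ℂ) + w) / K) t]
  congr 2
  push_cast
  field_simp
  ring

theorem charCot_add_self (φ : DirichletCharacter ℂ k) (w : ℂ) : charCot φ (w + k) = charCot φ w := by
  refine sum_congr rfl fun j _ => ?_
  have := cot_periodic (Nat.pos_of_neZero k) w j 1
  rw [Int.cast_natCast] at this
  rw [← this]
  push_cast
  congr 5
  ring

theorem charCot_neg (φ : DirichletCharacter ℂ k) (w : ℂ) :
    charCot φ (-w) = -(φ (-1) * charCot φ w) := by
  have h := sum_range_neg_of_periodic (Nat.pos_of_neZero k) (h := fun j : ℤ =>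
    φ (j : ZMod k) * (Real.pi / k * Complex.cot (Real.pi * (((j : ℂ) + -w) / k)))) fun x t => by
      rw [char_periodic, cot_periodic (Nat.pos_of_neZero k)]
  simp only [Int.cast_natCast] at h
  rw [charCot, ← h, charCot, mul_sum, ← sum_neg_distrib]
  refine sum_congr rfl fun j _ => ?_
  have e : (Real.pi * (((-(j : ℤ) : ℤ) : ℂ) + -w) / k : ℂ) = -(Real.pi * ((j + w) / k)) := by
    push_cast; ring
  rw [← mul_div_assoc, e, Complex.cot, Complex.cot, Complex.cos_neg, Complex.sin_neg, div_neg,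
    show ((-(j : ℤ) : ℤ) : ZMod k) = -1 * (j : ZMod k) by push_cast; ring, map_mul]
  ring

theorem gaussSum_sum_range {φ : DirichletCharacter ℂ k} (hφ : φ.IsPrimitive) (n : ℤ) :
    ∑ j ∈ range k, φ (j : ZMod k) * Complex.exp (2 * Real.pi * Complex.I * n * j / k) =
      φ⁻¹ (n : ZMod k) * G φ := by
  rw [G, ← gaussSum_mulShift_of_isPrimitive _ hφ, gaussSum, ← sum_range_natCast_zmod]
  refine sum_congr rfl fun j _ => ?_
  rw [AddChar.mulShift_apply, show (n : ZMod k) * (j : ZMod k) = ((n * j : ℤ) : ZMod k) by push_cast; ring,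
    ZMod.stdAddChar_coe]
  congr 2
  push_cast; ring

theorem sum_range_char_eq_zero {φ : DirichletCharacter ℂ k} (hφ : φ ≠ 1) :
    ∑ j ∈ range k, φ (j : ZMod k) = 0 := by
  rw [sum_range_natCast_zmod k fun x => φ x]
  exact MulChar.sum_eq_zero_of_ne_one hφ

/-- The Lambert series expansion of the cotangent sums in the upper half-plane. -/
theorem charCot_eq_tsum {φ : DirichletCharacter ℂ k} (hφ : φ.IsPrimitive) (hφ1 : φ ≠ 1) {w : ℂ}
    (hw : 0 < w.im) :
    charCot φ w = -(2 * Real.pi * Complex.I) / k * G φ *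
      ∑' m : ℕ+, φ⁻¹ ((m : ℕ) : ZMod k) *
        Complex.exp (2 * Real.pi * Complex.I * (m : ℕ) * w / k) := by
  have hk : (0 : ℝ) < k := by exact_mod_cast Nat.pos_of_neZero k
  have him : ∀ j : ℕ, 0 < ((j + w) / k : ℂ).im := fun j => by
    rw [Complex.div_natCast_im]; simp; positivity
  have hq : ∀ j : ℕ, ‖Complex.exp (2 * Real.pi * Complex.I * ((j + w) / k : ℂ))‖ < 1 := fun j =>
    UpperHalfPlane.norm_exp_two_pi_I_lt_one ⟨_, him j⟩
  have hcot : ∀ j : ℕ, Real.pi * Complex.cot (Real.pi * ((j + w) / k)) = Real.pi * Complex.I -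
      2 * Real.pi * Complex.I *
        ∑' n : ℕ, Complex.exp (2 * Real.pi * Complex.I * ((j + w) / k : ℂ)) ^ n := fun j =>
    pi_mul_cot_pi_q_exp ⟨_, him j⟩
  have h1 : charCot φ w = ∑ j ∈ range k, (φ (j : ZMod k) * (Real.pi * Complex.I / k) -
      2 * Real.pi * Complex.I / k * ∑' n : ℕ, φ (j : ZMod k) *
        Complex.exp (2 * Real.pi * Complex.I * ((j + w) / k : ℂ)) ^ n) := by
    refine sum_congr rfl fun j _ => ?_
    rw [div_mul_eq_mul_div, hcot, tsum_mul_left]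
    ring
  have hsum : ∀ j ∈ range k, Summable fun n : ℕ => φ (j : ZMod k) *
        Complex.exp (2 * Real.pi * Complex.I * ((j + w) / k : ℂ)) ^ n := fun j _ =>
    (summable_geometric_of_norm_lt_one (hq j)).mul_left _
  -- The constant term of each cotangent disappears because the character sums to zero; the sum over
  -- `j` inside the series is then a separable Gauss sum.
  rw [h1, sum_sub_distrib, ← sum_mul, sum_range_char_eq_zero hφ1, zero_mul, zero_sub, ← mul_sum,
    ← Summable.tsum_finsetSum hsum]
  have hterm : ∀ n : ℕ, ∑ j ∈ range k, φ (j : ZMod k) *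
        Complex.exp (2 * Real.pi * Complex.I * ((j + w) / k : ℂ)) ^ n =
      φ⁻¹ (n : ZMod k) * G φ * Complex.exp (2 * Real.pi * Complex.I * n * w / k) := by
    intro n
    have := gaussSum_sum_range hφ n
    simp only [Int.cast_natCast] at this
    rw [← this, sum_mul]
    refine sum_congr rfl fun j _ => ?_
    rw [← Complex.exp_nat_mul, mul_assoc (φ _), ← Complex.exp_add]
    congr 2
    ring
  have hs : Summable fun n : ℕ => φ⁻¹ (n : ZMod k) * G φ *
      Complex.exp (2 * Real.pi * Complex.I * n * w / k) := by
    simp only [← hterm]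
    exact summable_sum hsum
  have h0 : φ⁻¹ ((0 : ℕ) : ZMod k) = 0 := by
    rw [Nat.cast_zero]; exact char_zero (inv_ne_one.2 hφ1)
  simp only [hterm]
  rw [← tsum_zero_pnat_eq_tsum_nat hs, h0, zero_mul, zero_mul, zero_add, ← tsum_mul_left,
    ← tsum_mul_left, ← tsum_neg]
  exact tsum_congr fun m => by ring

end

/-! ### The weight on the lattice attached to a character and a pair `(c, 2δ)` -/

section

variable {k : ℕ}

/-- The weight `ψ(M) ψ̄(N)` at the lattice point with `M` odd and `n = Mδ - cN`. -/
noncomputable def latticeWeight (ψ : DirichletCharacter ℂ k) (c : ℕ) (δ n M : ℤ) : ℂ :=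
  if Odd M ∧ (c : ℤ) ∣ M * δ - n then
    ψ (M : ZMod k) * ψ⁻¹ (((M * δ - n) / c : ℤ) : ZMod k) else 0

theorem norm_latticeWeight_le (ψ : DirichletCharacter ℂ k) (c : ℕ) (δ n M : ℤ) :
    ‖latticeWeight ψ c δ n M‖ ≤ 1 := by
  rw [latticeWeight]
  split_ifs
  · rw [norm_mul]
    exact mul_le_one₀ (ψ.norm_le_one _) (norm_nonneg _) (DirichletCharacter.norm_le_one _ _)
  · simp

variable {ψ χ : DirichletCharacter ℂ k} {c : ℕ} {δ : ℤ}

/-- Parametrizes the support for fixed `M`. Here `N` has the opposite sign to the one in `n = Mδ -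
cN`, hence the factor at `-1`. -/
theorem latticeWeight_apply_add (hc : 0 < c) (M N : ℤ) :
    latticeWeight ψ c δ (M * δ + c * N) M =
      if Odd M then ψ⁻¹ (-1) * ψ (M : ZMod k) * ψ⁻¹ (N : ZMod k) else 0 := by
  have hc' : (c : ℤ) ≠ 0 := by exact_mod_cast hc.ne'
  have e : M * δ - (M * δ + c * N) = c * -N := by ring
  rw [latticeWeight, e, Int.mul_ediv_cancel_left _ hc']
  simp only [dvd_mul_right, and_true]
  split_ifs
  · rw [show ((-N : ℤ) : ZMod k) = -1 * (N : ZMod k) by push_cast; ring, map_mul]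
    ring
  · rfl

theorem latticeWeight_eq_zero_of_not_dvd {n M : ℤ} (h : ¬ (c : ℤ) ∣ n - M * δ) :
    latticeWeight ψ c δ n M = 0 := by
  rw [latticeWeight, if_neg]
  rintro ⟨-, h'⟩
  exact h ((dvd_sub_comm).1 h')

theorem latticeWeight_periodic_left (hc : 0 < c) (n M t : ℤ) :
    latticeWeight ψ c δ (n + (c * k : ℕ) * t) M = latticeWeight ψ c δ n M := by
  by_cases h : (c : ℤ) ∣ n - M * δ
  · obtain ⟨N, hN⟩ := h
    have e1 : n = M * δ + c * N := by linarith
    have e2 : n + (c * k : ℕ) * t = M * δ + c * (N + k * t) := by rw [e1]; push_cast; ring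
    rw [e2, e1, latticeWeight_apply_add hc, latticeWeight_apply_add hc, char_periodic]
  · rw [latticeWeight_eq_zero_of_not_dvd h, latticeWeight_eq_zero_of_not_dvd]
    intro h'
    refine h ((dvd_add_left (c := (c * k : ℕ) * t) ?_).1 ?_)
    · push_cast; exact ⟨k * t, by ring⟩
    · rwa [show n - M * δ + (c * k : ℕ) * t = n + (c * k : ℕ) * t - M * δ by ring]

theorem latticeWeight_periodic_right (hc : 0 < c) (n M t : ℤ) :
    latticeWeight ψ c δ n (M + (c * (2 * k) : ℕ) * t) = latticeWeight ψ c δ n M := by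
  have hc' : (c : ℤ) ≠ 0 := by exact_mod_cast hc.ne'
  have e : (M + (c * (2 * k) : ℕ) * t) * δ - n = (M * δ - n) + c * (k * (2 * t * δ)) := by
    push_cast; ring
  have ho : Odd (M + (c * (2 * k) : ℕ) * t) ↔ Odd M := by
    have : Even (((c * (2 * k) : ℕ) : ℤ) * t) := ⟨c * k * t, by push_cast; ring⟩
    constructor
    · intro h; simpa using h.sub_even this
    · intro h; exact h.add_even this
  simp only [latticeWeight, e, dvd_add_left (dvd_mul_right _ _), ho]
  rw [Int.add_mul_ediv_left _ _ hc', char_periodic,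
    show M + (c * (2 * k) : ℕ) * t = M + k * (c * 2 * t) by push_cast; ring, char_periodic]

theorem latticeWeight_apply_zero_right (n : ℤ) : latticeWeight ψ c δ n 0 = 0 := by
  rw [latticeWeight, if_neg]
  rintro ⟨h, -⟩
  exact absurd h (by decide)

variable {a b : ℤ} {κ : ℂ}

/-- Parametrizes the support for fixed `n` by the substitution `M = 2an + cl`, `N = bn + δl` of
determinant `1`. As `2a` is even and `c` odd, `M` and `l` have the same parity. -/
theorem latticeWeight_apply_mul_add (hc : 0 < c) (hco : Odd c) (hdet : a * (2 * δ) - b * c = 1)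
    (hκ : ∀ n l : ℤ, Odd l → ψ ((2 * a * n + c * l : ℤ) : ZMod k) *
      ψ⁻¹ ((b * n + δ * l : ℤ) : ZMod k) = κ * χ (n : ZMod k) * χ⁻¹ (l : ZMod k)) (n l : ℤ) :
    latticeWeight ψ c δ n (2 * a * n + c * l) =
      if Odd l then κ * χ (n : ZMod k) * χ⁻¹ (l : ZMod k) else 0 := by
  have hc' : (c : ℤ) ≠ 0 := by exact_mod_cast hc.ne'
  have e : (2 * a * n + c * l) * δ - n = c * (b * n + δ * l) := by
    linear_combination n * hdet
  have hco' : Odd (c : ℤ) := by exact_mod_cast hco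
  have ho : Odd (2 * a * n + c * l) ↔ Odd l := by
    have h2 : Even (2 * a * n) := ⟨a * n, by ring⟩
    constructor
    · intro h
      have h3 := h.sub_even h2
      rw [add_sub_cancel_left] at h3
      exact (Int.odd_mul.1 h3).2
    · intro h
      exact h2.add_odd (hco'.mul h)
  rw [latticeWeight, e, Int.mul_ediv_cancel_left _ hc']
  simp only [dvd_mul_right, and_true, ho]
  split_ifs with h
  · exact hκ n l h
  · rfl

/-- Since `2aδ ≡ 1` modulo `c`, the congruence `n ≡ Mδ` forces `M ≡ 2an`. -/
theorem latticeWeight_eq_zero_of_not_dvd' (hdet : a * (2 * δ) - b * c = 1) {n M : ℤ}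
    (h : ¬ (c : ℤ) ∣ M - 2 * a * n) : latticeWeight ψ c δ n M = 0 := by
  rw [latticeWeight, if_neg]
  rintro ⟨-, N, hN⟩
  exact h ⟨2 * a * N - b * M, by linear_combination 2 * a * hN - M * hdet⟩

theorem sum_latticeWeight_mul_right (hk : Odd k) (hc : 0 < c) (hco : Odd c)
    (hdet : a * (2 * δ) - b * c = 1)
    (hκ : ∀ n l : ℤ, Odd l → ψ ((2 * a * n + c * l : ℤ) : ZMod k) *
      ψ⁻¹ ((b * n + δ * l : ℤ) : ZMod k) = κ * χ (n : ZMod k) * χ⁻¹ (l : ZMod k)) (n : ℤ)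
    {f : ℤ → ℂ} (hf : ∀ x t, f (x + (c * (2 * k) : ℕ) * t) = f x) :
    ∑ i ∈ range (c * (2 * k)), latticeWeight ψ c δ n i * f i =
      κ * χ (n : ZMod k) * χ⁻¹ 2 * ∑ j ∈ range k, χ⁻¹ (j : ZMod k) *
        f (2 * a * n + c * (k + 2 * j)) := by
  have hk2 : 0 < 2 * k := Nat.mul_pos two_pos hk.pos
  rw [sum_range_mul_of_periodic (h := fun M => latticeWeight ψ c δ n M * f M) (x₀ := 2 * a * n) hc hk2
    (fun M t => by rw [latticeWeight_periodic_right hc, hf])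
    (fun M hM => by rw [latticeWeight_eq_zero_of_not_dvd' hdet hM, zero_mul])]
  simp only [latticeWeight_apply_mul_add hc hco hdet hκ]
  have h := sum_range_two_mul_odd hk (h := fun l : ℤ =>
    (if Odd l then κ * χ (n : ZMod k) * χ⁻¹ (l : ZMod k) else 0) * f (2 * a * n + c * l)) ?_ ?_
  · rw [h, mul_sum]
    refine sum_congr rfl fun j _ => ?_
    have ho : Odd ((k : ℤ) + 2 * j) := by
      have hk' : Odd (k : ℤ) := by exact_mod_cast hk
      exact hk'.add_even (even_two_mul _)
    rw [if_pos ho]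
    have : ((k + 2 * j : ℤ) : ZMod k) = 2 * (j : ZMod k) := by push_cast; simp
    rw [this, map_mul]
    ring
  · intro x t
    have ho : Odd (x + (2 * k : ℕ) * t) ↔ Odd x := by
      have : Even (((2 * k : ℕ) : ℤ) * t) := ⟨k * t, by push_cast; ring⟩
      constructor
      · intro h; simpa using h.sub_even this
      · intro h; exact h.add_even this
    simp only [ho]
    rw [show x + (2 * k : ℕ) * t = x + k * (2 * t) by push_cast; ring, char_periodic,
      show 2 * a * n + c * (x + k * (2 * t)) = 2 * a * n + c * x + (c * (2 * k) : ℕ) * t by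
        push_cast; ring, hf]
  · intro x hx
    rw [if_neg hx, zero_mul]

theorem latticeWeight_apply_zero_left (hc : 0 < c) (hco : Odd c)
    (hdet : a * (2 * δ) - b * c = 1) (hχ : χ ≠ 1)
    (hκ : ∀ n l : ℤ, Odd l → ψ ((2 * a * n + c * l : ℤ) : ZMod k) *
      ψ⁻¹ ((b * n + δ * l : ℤ) : ZMod k) = κ * χ (n : ZMod k) * χ⁻¹ (l : ZMod k)) (M : ℤ) :
    latticeWeight ψ c δ 0 M = 0 := by
  by_cases h : (c : ℤ) ∣ M - 2 * a * 0
  · obtain ⟨l, hl⟩ := h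
    have := latticeWeight_apply_mul_add hc hco hdet hκ 0 l
    rw [← hl, Int.cast_zero, char_zero hχ] at this
    simpa using this
  · exact latticeWeight_eq_zero_of_not_dvd' hdet h

variable [NeZero k]

theorem sum_latticeWeight_left (hc : 0 < c) (hψ : ψ ≠ 1) (M : ℤ) :
    ∑ i ∈ range (c * k), latticeWeight ψ c δ i M = 0 := by
  rw [sum_range_mul_of_periodic (h := fun n => latticeWeight ψ c δ n M) hc (Nat.pos_of_neZero k)
    (fun n t => latticeWeight_periodic_left hc n M t)
    (fun n hn => latticeWeight_eq_zero_of_not_dvd hn)]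
  simp only [latticeWeight_apply_add hc]
  split_ifs
  · rw [← mul_sum]
    simp only [Int.cast_natCast]
    rw [sum_range_char_eq_zero (inv_ne_one.2 hψ), mul_zero]
  · simp

/-- With `n = Mδ + cj`, the denominator `n + Mτ` equals `c(j + M(δ + τ)/c)`. -/
theorem cotSum_latticeWeight_left (hc : 0 < c) (τ : ℂ) (M : ℤ) :
    cotSum (c * k) τ (fun M n => latticeWeight ψ c δ n M) M =
      if Odd M then ψ⁻¹ (-1) * ψ (M : ZMod k) / c * charCot ψ⁻¹ (M * (δ + τ) / c) else 0 := by
  have hc0 : (c : ℂ) ≠ 0 := by exact_mod_cast hc.ne'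
  have hk0 : (k : ℂ) ≠ 0 := NeZero.ne _
  have hck : 0 < c * k := Nat.mul_pos hc (Nat.pos_of_neZero k)
  have h := sum_range_mul_of_periodic (h := fun i : ℤ => latticeWeight ψ c δ i M *
    (Real.pi / (c * k : ℕ) * Complex.cot (Real.pi * ((i + M * τ) / (c * k : ℕ))))) (x₀ := M * δ) hc
    (Nat.pos_of_neZero k)
    (fun n t => by rw [latticeWeight_periodic_left hc, cot_periodic hck])
    (fun n hn => by rw [latticeWeight_eq_zero_of_not_dvd hn, zero_mul])
  simp only [Int.cast_natCast] at h
  rw [cotSum, h]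
  simp only [latticeWeight_apply_add hc]
  split_ifs
  · rw [charCot, mul_sum]
    refine sum_congr rfl fun j _ => ?_
    have e : (((M * δ + c * (j : ℤ) : ℤ) : ℂ) + M * τ) / (c * k : ℕ) =
        (j + M * (δ + τ) / c) / k := by
      push_cast; field_simp; ring
    rw [e]
    push_cast
    field_simp
  · simp

theorem sum_latticeWeight_right (hk : Odd k) (hc : 0 < c) (hco : Odd c)
    (hdet : a * (2 * δ) - b * c = 1) (hχ : χ ≠ 1)
    (hκ : ∀ n l : ℤ, Odd l → ψ ((2 * a * n + c * l : ℤ) : ZMod k) *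
      ψ⁻¹ ((b * n + δ * l : ℤ) : ZMod k) = κ * χ (n : ZMod k) * χ⁻¹ (l : ZMod k)) (n : ℤ) :
    ∑ i ∈ range (c * (2 * k)), latticeWeight ψ c δ n i = 0 := by
  have h := sum_latticeWeight_mul_right hk hc hco hdet hκ n (f := fun _ => 1) fun _ _ => rfl
  simp only [mul_one] at h
  rw [h, sum_range_char_eq_zero (inv_ne_one.2 hχ), mul_zero]

/-- With `M = 2an + c(k + 2j)`, the denominator `M + nτ` is `2c` times `j + k/2 + n(2a + τ)/(2c)`.
-/
theorem cotSum_latticeWeight_right (hk : Odd k) (hc : 0 < c) (hco : Odd c)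
    (hdet : a * (2 * δ) - b * c = 1)
    (hκ : ∀ n l : ℤ, Odd l → ψ ((2 * a * n + c * l : ℤ) : ZMod k) *
      ψ⁻¹ ((b * n + δ * l : ℤ) : ZMod k) = κ * χ (n : ZMod k) * χ⁻¹ (l : ZMod k)) (τ : ℂ) (n : ℤ) :
    cotSum (c * (2 * k)) τ (latticeWeight ψ c δ) n =
      κ * χ (n : ZMod k) * χ⁻¹ 2 / (2 * c) * charCot χ⁻¹ (k / 2 + n * ((2 * a + τ) / (2 * c))) := by
  have hc0 : (c : ℂ) ≠ 0 := by exact_mod_cast hc.ne'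
  have hk0 : (k : ℂ) ≠ 0 := NeZero.ne _
  have hK : 0 < c * (2 * k) := Nat.mul_pos hc (Nat.mul_pos two_pos hk.pos)
  have h := sum_latticeWeight_mul_right hk hc hco hdet hκ n (f := fun i : ℤ =>
    (Real.pi / (c * (2 * k) : ℕ) * Complex.cot (Real.pi * ((i + n * τ) / (c * (2 * k) : ℕ)))))
    fun x t => by rw [cot_periodic hK]
  simp only [Int.cast_natCast] at h
  rw [cotSum, h, charCot, mul_sum, mul_sum]
  refine sum_congr rfl fun j _ => ?_
  have e : (((2 * a * n + c * (k + 2 * (j : ℤ)) : ℤ) : ℂ) + n * τ) / (c * (2 * k) : ℕ) =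
      (j + (k / 2 + n * ((2 * a + τ) / (2 * c)))) / k := by
    push_cast; field_simp; ring
  rw [e]
  push_cast
  field_simp

end

/-! ### The iterated sums as Lambert series -/

section

variable {k : ℕ}

theorem natCast_cpow_one_sub_sub_one (n p : ℕ) : (n : ℂ) ^ ((1 - (p : ℂ)) - 1) = 1 / (n : ℂ) ^ p := by
  rw [show (1 - (p : ℂ)) - 1 = -(p : ℂ) by ring, Complex.cpow_neg, Complex.cpow_natCast, one_div]

theorem tsum_int_one_div_pow_mul {p : ℕ} (hp : Odd p) {S : ℤ → ℂ} (hS : ∀ n, S (-n) = -S n)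
    (hs : Summable fun n : ℤ => 1 / (n : ℂ) ^ p * S n) :
    ∑' n : ℤ, 1 / (n : ℂ) ^ p * S n = 2 * ∑' n : ℕ+, 1 / ((n : ℕ) : ℂ) ^ p * S ((n : ℕ) : ℤ) := by
  have he : (fun n : ℤ => 1 / (n : ℂ) ^ p * S n).Even := fun n => by
    simp only [hS, Int.cast_neg, hp.neg_pow]
    rw [div_neg, neg_mul_neg]
  rw [tsum_int_eq_zero_add_two_mul_tsum_pnat he hs]
  simp [hp.pos.ne']

theorem char_neg_one_mul_self (φ : DirichletCharacter ℂ k) : φ (-1) * φ (-1) = 1 := by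
  rw [← map_mul, neg_one_mul, neg_neg, map_one]

theorem inv_char_neg_one (φ : DirichletCharacter ℂ k) : φ⁻¹ (-1) = φ (-1) := by
  have h : φ⁻¹ (-1) * φ (-1) = 1 := by
    rw [← MulChar.mul_apply, inv_mul_cancel, MulChar.one_apply isUnit_one.neg]
  calc φ⁻¹ (-1) = φ⁻¹ (-1) * (φ (-1) * φ (-1)) := by rw [char_neg_one_mul_self, mul_one]
    _ = φ (-1) := by rw [← mul_assoc, h, one_mul]

theorem char_intCast_neg (φ : DirichletCharacter ℂ k) (n : ℤ) :
    φ ((-n : ℤ) : ZMod k) = φ (-1) * φ (n : ZMod k) := by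
  rw [← map_mul]; congr 1; push_cast; ring

/-- A character and its inverse factor through the same levels, hence have equal conductors. -/
theorem isPrimitive_inv {χ : DirichletCharacter ℂ k} (h : χ.IsPrimitive) : χ⁻¹.IsPrimitive := by
  have key : ∀ d, χ⁻¹.FactorsThrough d → χ.FactorsThrough d := fun d ⟨hd, χ₀, h₀⟩ =>
    ⟨hd, χ₀⁻¹, by rw [map_inv, ← h₀, inv_inv]⟩
  have key' : ∀ d, χ.FactorsThrough d → χ⁻¹.FactorsThrough d := fun d ⟨hd, χ₀, h₀⟩ =>
    ⟨hd, χ₀⁻¹, by rw [map_inv, ← h₀]⟩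
  have : χ⁻¹.conductor = χ.conductor := by
    unfold DirichletCharacter.conductor DirichletCharacter.conductorSet
    congr 1
    ext d
    exact ⟨key d, key' d⟩
  rw [DirichletCharacter.isPrimitive_def] at *
  rw [this, h]

variable [NeZero k] {ψ χ : DirichletCharacter ℂ k} {c : ℕ} {δ : ℤ}

theorem tsum_charCot_eq_A1 (hχp : χ.IsPrimitive) (hχ : χ ≠ 1) {R : ℂ} (hR : 0 < R.im) (p : ℕ) :
    ∑' n : ℕ+, 1 / ((n : ℕ) : ℂ) ^ p * (χ ((n : ℕ) : ZMod k) *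
      charCot χ⁻¹ (k / 2 + ((n : ℕ) : ℂ) * R)) =
      -(2 * Real.pi * Complex.I) / k * G χ⁻¹ * A1 R (1 - (p : ℂ)) χ := by
  have hk0 : (k : ℂ) ≠ 0 := NeZero.ne _
  rw [A1, ← tsum_mul_left]
  refine tsum_congr fun n => ?_
  have him : 0 < (k / 2 + ((n : ℕ) : ℂ) * R).im := by
    have : (0 : ℝ) < (n : ℕ) := by exact_mod_cast n.pos
    simp; positivity
  rw [charCot_eq_tsum (isPrimitive_inv hχp) (inv_ne_one.2 hχ) him, inv_inv, ← tsum_mul_left,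
    ← tsum_mul_left, ← tsum_mul_left, ← tsum_mul_left]
  refine tsum_congr fun m => ?_
  -- The half-period shift `k/2` contributes `e^{πim}`, the alternating sign in `A1`.
  have e : Complex.exp (2 * Real.pi * Complex.I * ((m : ℕ) : ℂ) * (k / 2 + ((n : ℕ) : ℂ) * R) / k) =
      (-1) ^ (m : ℕ) *
        Complex.exp (2 * Real.pi * Complex.I * ((m : ℕ) : ℂ) * ((n : ℕ) : ℂ) * R / k) := by
    rw [← Complex.exp_pi_mul_I, ← Complex.exp_nat_mul, ← Complex.exp_add]
    congr 1
    field_simp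
  rw [e, natCast_cpow_one_sub_sub_one]
  ring

theorem tsum_charCot_eq_B (hψp : ψ.IsPrimitive) (hψ : ψ ≠ 1) {z : ℂ} (hz : 0 < z.im) (p : ℕ) :
    ∑' n : ℕ+, 1 / ((n : ℕ) : ℂ) ^ p * (if Odd (n : ℕ) then ψ ((n : ℕ) : ZMod k) *
      charCot ψ⁻¹ (((n : ℕ) : ℂ) * (z / 2)) else 0) =
      -(2 * Real.pi * Complex.I) / k * G ψ⁻¹ * B z (1 - (p : ℂ)) ψ := by
  have hinj : Function.Injective fun n : ℕ => Nat.succPNat (2 * n) := fun x y h => by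
    have := Nat.succPNat_inj.1 h
    omega
  rw [← hinj.tsum_eq, B, ← tsum_mul_left]
  · refine tsum_congr fun n => ?_
    rw [if_pos (show Odd ((Nat.succPNat (2 * n) : ℕ+) : ℕ) from odd_two_mul_add_one n)]
    simp only [Nat.succPNat_coe, Nat.succ_eq_add_one]
    have him : 0 < (((2 * n + 1 : ℕ) : ℂ) * (z / 2)).im := by
      have : (0 : ℝ) < ((2 * n + 1 : ℕ) : ℝ) := by positivity
      rw [← Complex.ofReal_natCast, Complex.im_ofReal_mul, Complex.div_ofNat_im]
      positivity
    rw [charCot_eq_tsum (isPrimitive_inv hψp) (inv_ne_one.2 hψ) him, inv_inv, ← tsum_mul_left,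
      ← tsum_mul_left, ← tsum_mul_left, ← tsum_mul_left]
    refine tsum_congr fun m => ?_
    have e : 2 * Real.pi * Complex.I * ((m : ℕ) : ℂ) * (((2 * n + 1 : ℕ) : ℂ) * (z / 2)) / k =
        Real.pi * Complex.I * ((m : ℕ) : ℂ) * ((2 * n + 1 : ℕ) : ℂ) * z / k := by
      ring
    rw [e, natCast_cpow_one_sub_sub_one]
    ring
  · intro n hn
    rw [Function.mem_support] at hn
    by_cases ho : Odd (n : ℕ)
    · obtain ⟨m, hm⟩ := ho
      exact ⟨m, PNat.eq (by rw [hm]; rfl)⟩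
    · simp [ho] at hn

theorem tsum_cotSum_latticeWeight_left (hψp : ψ.IsPrimitive) (hψ : ψ ≠ 1) (hc : 0 < c) {z : ℂ}
    (hz : 0 < z.im) {p : ℕ} (hp : Odd p) :
    ∑' M : ℤ, 1 / (M : ℂ) ^ p *
      cotSum (c * k) (-((c * z + 2 * δ) / 2)) (fun M n => latticeWeight ψ c δ n M) M =
      -(2 / c * (-(2 * Real.pi * Complex.I) / k * G ψ⁻¹ * B z (1 - (p : ℂ)) ψ)) := by
  have hc0 : (c : ℂ) ≠ 0 := by exact_mod_cast hc.ne'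
  have hc1 : (0 : ℝ) < c := by exact_mod_cast hc
  set τ : ℂ := -((c * z + 2 * δ) / 2) with hτ
  have hτim : τ.im ≠ 0 := by
    have : τ.im = -(c * z.im / 2) := by
      rw [hτ, Complex.neg_im, Complex.div_ofNat_im]; simp
    rw [this]
    have := mul_pos hc1 hz
    exact (show -(c * z.im / 2) < 0 by linarith).ne
  have hS : ∀ M : ℤ, cotSum (c * k) τ (fun M n => latticeWeight ψ c δ n M) M =
      -(1 / c) * if Odd M then ψ (M : ZMod k) * charCot ψ⁻¹ (M * (z / 2)) else 0 := by
    intro M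
    rw [cotSum_latticeWeight_left hc]
    split_ifs
    · rw [show (M : ℂ) * (δ + τ) / c = -(M * (z / 2)) by rw [hτ]; field_simp; ring, charCot_neg]
      linear_combination (-(ψ (M : ZMod k)) / c * charCot ψ⁻¹ (M * (z / 2))) *
        char_neg_one_mul_self ψ⁻¹
    · simp
  have hodd : ∀ M : ℤ, cotSum (c * k) τ (fun M n => latticeWeight ψ c δ n M) (-M) =
      -cotSum (c * k) τ (fun M n => latticeWeight ψ c δ n M) M := by
    intro M
    rw [hS, hS]
    simp only [odd_neg]
    split_ifs
    · rw [char_intCast_neg, Int.cast_neg, neg_mul (M : ℂ), charCot_neg, inv_char_neg_one]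
      linear_combination (1 / c * ψ (M : ZMod k) * charCot ψ⁻¹ (M * (z / 2))) *
        char_neg_one_mul_self ψ
    · simp
  have hsum := (summable_and_tendsto_cotSum (Nat.mul_pos hc (Nat.pos_of_neZero k)) hp.pos hτim
    (w := fun M n => latticeWeight ψ c δ n M) (fun q r => norm_latticeWeight_le ψ c δ r q)
    (fun q r t => latticeWeight_periodic_left hc r q t) (sum_latticeWeight_left hc hψ)
    tendsto_Ico_neg_atTop).1
  rw [tsum_int_one_div_pow_mul hp hodd hsum, ← tsum_charCot_eq_B hψp hψ hz]
  simp only [hS, Int.odd_coe_nat, Int.cast_natCast]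
  rw [← tsum_mul_left, ← tsum_mul_left, ← tsum_neg]
  exact tsum_congr fun n => by ring

variable {a b : ℤ} {κ : ℂ}

theorem tsum_cotSum_latticeWeight_right (hk : Odd k) (hχp : χ.IsPrimitive) (hχ : χ ≠ 1)
    (hc : 0 < c) (hco : Odd c) (hdet : a * (2 * δ) - b * c = 1)
    (hκ : ∀ n l : ℤ, Odd l → ψ ((2 * a * n + c * l : ℤ) : ZMod k) *
      ψ⁻¹ ((b * n + δ * l : ℤ) : ZMod k) = κ * χ (n : ZMod k) * χ⁻¹ (l : ZMod k))
    {τ : ℂ} (hτ : 0 < τ.im) {p : ℕ} (hp : Odd p) :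
    ∑' n : ℤ, 1 / (n : ℂ) ^ p * cotSum (c * (2 * k)) τ (latticeWeight ψ c δ) n =
      κ * χ⁻¹ 2 / c * (-(2 * Real.pi * Complex.I) / k * G χ⁻¹ *
        A1 ((2 * a + τ) / (2 * c)) (1 - (p : ℂ)) χ) := by
  have hc0 : (c : ℂ) ≠ 0 := by exact_mod_cast hc.ne'
  have hc1 : (0 : ℝ) < c := by exact_mod_cast hc
  set R : ℂ := (2 * a + τ) / (2 * c) with hR
  have hRim : 0 < R.im := by
    have : R = (2 * a + τ) / (2 * c : ℕ) := by rw [hR]; push_cast; rfl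
    rw [this, Complex.div_natCast_im]
    have : (2 * a + τ).im = τ.im := by simp
    rw [this]
    have : (0 : ℝ) < (2 * c : ℕ) := by positivity
    positivity
  have hS := cotSum_latticeWeight_right hk hc hco hdet hκ τ
  have hodd : ∀ n : ℤ, cotSum (c * (2 * k)) τ (latticeWeight ψ c δ) (-n) =
      -cotSum (c * (2 * k)) τ (latticeWeight ψ c δ) n := by
    intro n
    -- Period `k` makes the shift `k/2` compatible with the reflection `n ↦ -n`.
    rw [hS, hS, char_intCast_neg, ← hR, show (k / 2 + ((-n : ℤ) : ℂ) * R) = -(k / 2 + n * R) + k by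
      push_cast; ring, charCot_add_self, charCot_neg, inv_char_neg_one]
    linear_combination (-(κ * χ (n : ZMod k) * χ⁻¹ 2 / (2 * c)) * charCot χ⁻¹ (k / 2 + n * R)) *
      char_neg_one_mul_self χ
  have hsum := (summable_and_tendsto_cotSum (Nat.mul_pos hc (Nat.mul_pos two_pos hk.pos)) hp.pos
    hτ.ne' (w := latticeWeight ψ c δ) (fun q r => norm_latticeWeight_le ψ c δ q r)
    (fun q r t => latticeWeight_periodic_right hc q r t)
    (sum_latticeWeight_right hk hc hco hdet hχ hκ) tendsto_Ico_neg_atTop).1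
  rw [tsum_int_one_div_pow_mul hp hodd hsum, ← tsum_charCot_eq_A1 hχp hχ hRim]
  simp only [hS, ← hR, Int.cast_natCast]
  rw [← tsum_mul_left, ← tsum_mul_left]
  exact tsum_congr fun n => by ring

end

/-! ### Finite Fourier expansion of the lattice weight -/

theorem bernoulliPer_neg (m : ℕ) (x : ℝ) : bernoulliPer m (-x) = (-1) ^ m * bernoulliPer m x := by
  simp only [bernoulliPer, Int.fract_neg_eq_zero]
  by_cases hx : Int.fract x = 0
  · have hx' : Int.fract (-x) = 0 := Int.fract_neg_eq_zero.2 hx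
    by_cases hm : m = 1
    · simp [hm, hx]
    · rw [if_neg (by tauto), if_neg (by tauto), hx, hx', ← bernoulliFun_eval_one_sub, sub_zero,
        bernoulliFun_endpoints_eq_of_ne_one hm]
  · rw [if_neg (by tauto), if_neg (by tauto), Int.fract_neg hx, bernoulliFun_eval_one_sub]

theorem sum_Icc_one_of_periodic {K : ℕ} (hK : 0 < K) {h : ℤ → ℂ}
    (hh : ∀ x t, h (x + K * t) = h x) :
    ∑ i ∈ Icc (1 : ℤ) K, h i = ∑ i ∈ range K, h i := by
  rw [← sum_range_add_of_periodic hK hh 1]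
  symm
  refine sum_nbij' (fun i => 1 + (i : ℤ)) (fun r => (r - 1).toNat) ?_ ?_ ?_ ?_ ?_
  · intro i hi; simp only [mem_range, mem_Icc] at *; omega
  · intro i hi; simp only [mem_range, mem_Icc] at *; omega
  · intro i hi; simp
  · intro i hi; simp only [mem_Icc] at *; omega
  · intro i hi; rfl

theorem sum_range_mul_eq_sum_sum (c k : ℕ) (hk : 0 < k) (f : ℕ → ℂ) :
    ∑ ν ∈ range (c * k), f ν = ∑ q ∈ range c, ∑ i ∈ range k, f (i + k * q) := by
  rw [← sum_product']
  symm
  refine sum_nbij' (fun x => x.2 + k * x.1) (fun r => (r / k, r % k)) ?_ ?_ ?_ ?_ ?_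
  · rintro ⟨q, i⟩ h
    simp only [mem_product, mem_range] at h ⊢
    calc i + k * q < k + k * q := by omega
      _ = (q + 1) * k := by ring
      _ ≤ c * k := Nat.mul_le_mul_right _ h.1
  · intro r h
    simp only [mem_product, mem_range] at h ⊢
    exact ⟨(Nat.div_lt_iff_lt_mul hk).2 h, Nat.mod_lt _ hk⟩
  · rintro ⟨q, i⟩ h
    simp only [mem_product, mem_range] at h
    simp only [Nat.add_mul_div_left _ _ hk, Nat.add_mul_mod_self_left, Nat.mod_eq_of_lt h.2,
      Nat.div_eq_of_lt h.2, zero_add]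
  · intro r _
    exact Nat.mod_add_div r k
  · intro x _
    rfl

theorem sum_range_exp_div {c : ℕ} (hc : 0 < c) (t : ℤ) :
    ∑ q ∈ range c, Complex.exp (2 * Real.pi * Complex.I * t / c) ^ q =
      if (c : ℤ) ∣ t then (c : ℂ) else 0 := by
  have hc0 : (c : ℂ) ≠ 0 := by exact_mod_cast hc.ne'
  have hpi : (2 * Real.pi * Complex.I : ℂ) ≠ 0 := Complex.two_pi_I_ne_zero
  have hiff : Complex.exp (2 * Real.pi * Complex.I * t / c) = 1 ↔ (c : ℤ) ∣ t := by
    rw [Complex.exp_eq_one_iff]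
    constructor
    · rintro ⟨n, hn⟩
      refine ⟨n, ?_⟩
      have : (t : ℂ) = c * n := by
        field_simp at hn
        linear_combination hn
      exact_mod_cast this
    · rintro ⟨n, rfl⟩
      refine ⟨n, ?_⟩
      push_cast; field_simp
  split_ifs with h
  · rw [hiff.2 h]; simp
  · have hne : Complex.exp (2 * Real.pi * Complex.I * t / c) ≠ 1 := fun h' => h (hiff.1 h')
    rw [geom_sum_eq hne, ← Complex.exp_nat_mul]
    have : (c : ℂ) * (2 * Real.pi * Complex.I * t / c) = t * (2 * Real.pi * Complex.I) := by
      field_simp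
    rw [this, Complex.exp_int_mul_two_pi_mul_I, sub_self, zero_div]

theorem char_two_mul_inv_char_two {k : ℕ} {ψ : DirichletCharacter ℂ k} (hk : Odd k) : ψ 2 * ψ⁻¹ 2 = 1 := by
  have hu : IsUnit (2 : ZMod k) := by
    have := (ZMod.isUnit_iff_coprime 2 k).2 (Nat.coprime_two_left.2 hk)
    simpa using this
  rw [← MulChar.mul_apply, mul_inv_cancel, MulChar.one_apply hu]

section

variable {k : ℕ} [NeZero k] {ψ : DirichletCharacter ℂ k} {c : ℕ} {δ : ℤ}

/-- The discrete Fourier transform sends a primitive character to a Gauss sum multiple of its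
inverse, and applying it twice is `k` times reflection. -/
theorem G_mul_G_inv (hψ : ψ.IsPrimitive) : G ψ * G ψ⁻¹ = ψ (-1) * k := by
  have h1 : ZMod.dft ψ = fun j => ψ (-1) * G ψ * ψ⁻¹ j := by
    ext j
    rw [hψ.fourierTransform_eq_inv_mul_gaussSum, ← inv_char_neg_one, ← neg_one_mul, map_mul, G]
    ring
  have h2 := congrFun (ZMod.dft_dft (ψ : ZMod k → ℂ)) (-1)
  have h3 : ZMod.dft (fun j => ψ (-1) * G ψ * ψ⁻¹ j) = (ψ (-1) * G ψ) • ZMod.dft (fun j => ψ⁻¹ j) := by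
    rw [← map_smul]; rfl
  rw [h1, h3, Pi.smul_apply,
    show (fun j => ψ⁻¹ j) = ⇑ψ⁻¹ from rfl, (isPrimitive_inv hψ).fourierTransform_eq_inv_mul_gaussSum] at h2
  simp only [neg_neg, map_one, one_mul, smul_eq_mul, mul_one] at h2
  rw [← h2, G, G]
  linear_combination (-(gaussSum ψ (ZMod.stdAddChar (N := k)) *
    gaussSum ψ⁻¹ (ZMod.stdAddChar (N := k)))) * char_neg_one_mul_self ψ

/-- Writing `ν = i + kq`, the sum over `q` detects `c ∣ t`, and the sum over `i` is a separable
Gauss sum at `t/c`. -/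
theorem sum_range_char_mul_exp (hψ : ψ.IsPrimitive) (hc : 0 < c) (t : ℤ) :
    ∑ ν ∈ range (c * k), ψ (ν : ZMod k) * Complex.exp (2 * Real.pi * Complex.I * (ν * t) / (c * k)) =
      if (c : ℤ) ∣ t then c * (ψ⁻¹ ((t / c : ℤ) : ZMod k) * G ψ) else 0 := by
  have hc0 : (c : ℂ) ≠ 0 := by exact_mod_cast hc.ne'
  have hk0 : (k : ℂ) ≠ 0 := NeZero.ne _
  have hsplit : ∑ ν ∈ range (c * k),
      ψ (ν : ZMod k) * Complex.exp (2 * Real.pi * Complex.I * (ν * t) / (c * k)) =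
      (∑ q ∈ range c, Complex.exp (2 * Real.pi * Complex.I * t / c) ^ q) *
        ∑ i ∈ range k, ψ (i : ZMod k) *
          Complex.exp (2 * Real.pi * Complex.I * (i * t) / (c * k)) := by
    rw [sum_range_mul_eq_sum_sum c k (Nat.pos_of_neZero k), sum_mul]
    refine sum_congr rfl fun q _ => ?_
    rw [mul_sum]
    refine sum_congr rfl fun i _ => ?_
    rw [← Complex.exp_nat_mul, mul_left_comm (Complex.exp _), ← Complex.exp_add]
    congr 1
    · simp
    · congr 1
      push_cast; field_simp; ring
  rw [hsplit, sum_range_exp_div hc]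
  split_ifs with h
  · obtain ⟨s, rfl⟩ := h
    rw [Int.mul_ediv_cancel_left _ (by exact_mod_cast hc.ne'), ← gaussSum_sum_range hψ]
    congr 1
    refine sum_congr rfl fun i _ => ?_
    congr 2
    push_cast; field_simp
  · rw [zero_mul]

/-- Since `M + k = 2s` is even, the sign `(-1)^j` turns `e^{πiMj/k}` into `e^{2πisj/k}`; modulo `k`,
`M ≡ 2s`. -/
theorem sum_range_neg_one_pow_mul_exp (hk : Odd k) (hψ : ψ.IsPrimitive) {M : ℤ} (hM : Odd M) :
    ∑ j ∈ range k, (-1 : ℂ) ^ j * ψ⁻¹ (j : ZMod k) *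
      Complex.exp (Real.pi * Complex.I * M * j / k) = ψ⁻¹ 2 * ψ (M : ZMod k) * G ψ⁻¹ := by
  have hk0 : (k : ℂ) ≠ 0 := NeZero.ne _
  have hk' : Odd (k : ℤ) := by exact_mod_cast hk
  obtain ⟨s, hs⟩ := hM.add_odd hk'
  have hMs : ψ (M : ZMod k) = ψ 2 * ψ (s : ZMod k) := by
    rw [← map_mul]
    congr 1
    have := congrArg (Int.cast : ℤ → ZMod k) hs
    push_cast at this
    rw [ZMod.natCast_self, add_zero] at this
    rw [this]; ring
  have hg := gaussSum_sum_range (isPrimitive_inv hψ) s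
  rw [inv_inv] at hg
  rw [hMs, ← mul_assoc, mul_comm (ψ⁻¹ 2), char_two_mul_inv_char_two hk, one_mul, ← hg]
  refine sum_congr rfl fun j _ => ?_
  rw [mul_comm ((-1 : ℂ) ^ j), mul_assoc, ← Complex.exp_pi_mul_I, ← Complex.exp_nat_mul,
    ← Complex.exp_add]
  congr 2
  have hsc : (M : ℂ) = s + s - k := by
    have : M = s + s - k := by linarith
    rw [this]; push_cast; ring
  rw [hsc]
  field_simp
  ring

/-- The finite Fourier expansion of `latticeWeight`. -/
theorem sum_exp_eq_latticeWeight (hk : Odd k) (hψ : ψ.IsPrimitive) (hc : 0 < c) (n : ℤ) {M : ℤ}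
    (hM : Odd M) :
    ∑ ν ∈ Icc (1 : ℤ) (c * k : ℕ), ∑ j ∈ range k, ψ (ν : ZMod k) * ((-1 : ℂ) ^ j * ψ⁻¹ (j : ZMod k)) *
      (Complex.exp (2 * Real.pi * Complex.I * n * ((-(ν / (c * k)) : ℝ) : ℂ)) *
        Complex.exp (Real.pi * Complex.I * M * (((j + 2 * δ * ν / c) / k : ℝ) : ℂ))) =
      ψ⁻¹ 2 * ψ (-1) * k * c * latticeWeight ψ c δ n M := by
  have hc0 : (c : ℂ) ≠ 0 := by exact_mod_cast hc.ne'
  have hk0 : (k : ℂ) ≠ 0 := NeZero.ne _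
  have hfac : ∀ (ν : ℤ) (j : ℕ), ψ (ν : ZMod k) * ((-1 : ℂ) ^ j * ψ⁻¹ (j : ZMod k)) *
      (Complex.exp (2 * Real.pi * Complex.I * n * ((-(ν / (c * k)) : ℝ) : ℂ)) *
        Complex.exp (Real.pi * Complex.I * M * (((j + 2 * δ * ν / c) / k : ℝ) : ℂ))) =
      (ψ (ν : ZMod k) * Complex.exp (2 * Real.pi * Complex.I * (ν * ((M * δ - n : ℤ) : ℂ)) / (c * k))) *
      ((-1 : ℂ) ^ j * ψ⁻¹ (j : ZMod k) * Complex.exp (Real.pi * Complex.I * M * j / k)) := by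
    intro ν j
    -- Regrouping the exponents separates `ν` from `j`; the `ν`-part depends on `n` and `M` only
    -- through `Mδ - n`.
    have : Complex.exp (2 * Real.pi * Complex.I * n * ((-(ν / (c * k)) : ℝ) : ℂ)) *
        Complex.exp (Real.pi * Complex.I * M * (((j + 2 * δ * ν / c) / k : ℝ) : ℂ)) =
        Complex.exp (2 * Real.pi * Complex.I * (ν * ((M * δ - n : ℤ) : ℂ)) / (c * k)) *
        Complex.exp (Real.pi * Complex.I * M * j / k) := by
      rw [← Complex.exp_add, ← Complex.exp_add]
      congr 1
      push_cast
      field_simp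
      ring
    rw [this]; ring
  simp only [hfac, ← mul_sum, sum_range_neg_one_pow_mul_exp hk hψ hM]
  rw [← sum_mul, sum_Icc_one_of_periodic (h := fun ν : ℤ => ψ (ν : ZMod k) *
    Complex.exp (2 * Real.pi * Complex.I * (ν * ((M * δ - n : ℤ) : ℂ)) / (c * k)))
    (Nat.mul_pos hc (Nat.pos_of_neZero k))]
  · simp only [Int.cast_natCast]
    rw [sum_range_char_mul_exp hψ hc, latticeWeight]
    by_cases h : (c : ℤ) ∣ M * δ - n
    · rw [if_pos h, if_pos ⟨hM, h⟩]
      linear_combination (c * ψ⁻¹ (((M * δ - n) / c : ℤ) : ZMod k) * ψ⁻¹ 2 * ψ (M : ZMod k)) *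
        G_mul_G_inv hψ
    · rw [if_neg h, if_neg fun h' => h h'.2]; ring
  · intro x t
    rw [show x + (c * k : ℕ) * t = x + k * (c * t) by push_cast; ring, char_periodic]
    congr 1
    rw [Complex.exp_eq_exp_iff_exists_int]
    refine ⟨t * (M * δ - n), ?_⟩
    push_cast
    field_simp

end

theorem sum_comm_four {α β γ ε : Type*} (A : Finset α) (B : Finset β) (C : Finset γ) (D : Finset ε)
    (f : α → β → γ → ε → ℂ) :
    ∑ i ∈ A, ∑ j ∈ B, ∑ x ∈ C, ∑ y ∈ D, f i j x y =
      ∑ x ∈ C, ∑ y ∈ D, ∑ i ∈ A, ∑ j ∈ B, f i j x y := by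
  have h1 : ∑ i ∈ A, ∑ j ∈ B, ∑ x ∈ C, ∑ y ∈ D, f i j x y =
      ∑ u ∈ A ×ˢ B, ∑ v ∈ C ×ˢ D, f u.1 u.2 v.1 v.2 := by
    simp only [sum_product]
  rw [h1, sum_comm]
  simp only [sum_product]

section

variable {k : ℕ} [NeZero k] {ψ : DirichletCharacter ℂ k} {c : ℕ} {a b δ : ℤ}

/-- Keeps the argument of `ℰ_0` away from its jumps. Integrality would force `ν = cμ` and `j ≡ -2δμ`
modulo `k`, making the character product a multiple of `ψ(c) ψ̄(δ) = 0`. -/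
theorem fract_ne_zero_of_char_ne_zero (hc : 0 < c) (hdet : a * (2 * δ) - b * c = 1)
    (h0 : ψ (c : ZMod k) * ψ⁻¹ (δ : ZMod k) = 0) {ν : ℤ} {j : ℕ}
    (h : ψ (ν : ZMod k) * ψ⁻¹ (j : ZMod k) ≠ 0) :
    Int.fract ((j + 2 * δ * ν / c) / k : ℝ) ≠ 0 := by
  intro hf
  have hc0 : (c : ℝ) ≠ 0 := by exact_mod_cast hc.ne'
  have hk0 : (k : ℝ) ≠ 0 := NeZero.ne _
  obtain ⟨t, ht⟩ := Int.fract_eq_zero_iff.1 hf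
  have h1 : (j : ℤ) * c + 2 * δ * ν = t * k * c := by
    have : (j : ℝ) * c + 2 * δ * ν = t * k * c := by
      rw [ht]; field_simp
    exact_mod_cast this
  have hdvd : (c : ℤ) ∣ ν := ⟨a * (t * k - j) - b * ν, by linear_combination a * h1 - ν * hdet⟩
  obtain ⟨μ, rfl⟩ := hdvd
  have h2 : (j : ℤ) = δ * (-2 * μ) + k * t := by
    have hc' : (c : ℤ) ≠ 0 := by exact_mod_cast hc.ne'
    apply mul_right_cancel₀ hc'
    linear_combination h1
  have h3 : (j : ZMod k) = δ * ((-2 * μ : ℤ) : ZMod k) := by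
    have := congrArg (Int.cast : ℤ → ZMod k) h2
    push_cast at this ⊢
    rw [this]; simp
  apply h
  rw [h3, Int.cast_mul, Int.cast_natCast, map_mul, map_mul]
  linear_combination (ψ (μ : ZMod k) * ψ⁻¹ ((-2 * μ : ℤ) : ZMod k)) * h0

/-- The box sums of `W(n, M) M^{-q-1} n^{-m}` converge to a generalized Dedekind sum. -/
theorem tendsto_sum_latticeWeight (hk : Odd k) (hψ : ψ.IsPrimitive) (hc : 0 < c)
    (hdet : a * (2 * δ) - b * c = 1) (h0 : ψ (c : ZMod k) * ψ⁻¹ (δ : ZMod k) = 0)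
    {m : ℕ} (hm : 1 ≤ m) (q : ℕ) :
    Tendsto (fun T : ℕ => ∑ n ∈ Ico (-((c * k * T : ℕ) : ℤ)) (c * k * T : ℕ),
      ∑ M ∈ Ico (-((c * (2 * k) * T : ℕ) : ℤ)) (c * (2 * k) * T : ℕ),
        latticeWeight ψ c δ n M * (1 / ((M : ℂ) ^ (q + 1) * (n : ℂ) ^ m))) atTop
      (𝓝 (ψ 2 * ψ (-1) / (k * c) * ∑ ν ∈ Icc (1 : ℤ) (c * k : ℕ), ∑ j ∈ range k,
        ψ (ν : ZMod k) * ((-1 : ℂ) ^ j * ψ⁻¹ (j : ZMod k)) *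
        ((-(2 * Real.pi * Complex.I) ^ m / (m.factorial : ℂ) * (bernoulliPer m (-(ν / (c * k))) : ℂ)) *
        ((Real.pi * Complex.I) ^ (q + 1) / (2 * (q.factorial : ℂ)) *
          (eulerPer q ((j + 2 * δ * ν / c) / k) : ℂ))))) := by
  have hc0 : (c : ℂ) ≠ 0 := by exact_mod_cast hc.ne'
  have hk0 : (k : ℂ) ≠ 0 := NeZero.ne _
  have hT1 : Tendsto (fun T : ℕ => c * k * T) atTop atTop :=
    tendsto_id.const_mul_atTop' (Nat.mul_pos hc hk.pos)
  have hT2 : Tendsto (fun T : ℕ => c * (2 * k) * T) atTop atTop :=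
    tendsto_id.const_mul_atTop' (Nat.mul_pos hc (Nat.mul_pos two_pos hk.pos))
  have hlim : Tendsto (fun T : ℕ => ψ 2 * ψ (-1) / (k * c) * ∑ ν ∈ Icc (1 : ℤ) (c * k : ℕ),
      ∑ j ∈ range k, ψ (ν : ZMod k) * ((-1 : ℂ) ^ j * ψ⁻¹ (j : ZMod k)) *
      ((∑ n ∈ Ico (-((c * k * T : ℕ) : ℤ)) (c * k * T : ℕ),
          Complex.exp (2 * Real.pi * Complex.I * n * ((-(ν / (c * k)) : ℝ) : ℂ)) / (n : ℂ) ^ m) *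
        ∑ M ∈ Ico (-((c * (2 * k) * T : ℕ) : ℤ)) (c * (2 * k) * T : ℕ), if Odd M then
          Complex.exp (Real.pi * Complex.I * M * (((j + 2 * δ * ν / c) / k : ℝ) : ℂ)) /
            (M : ℂ) ^ (q + 1) else 0)) atTop
      (𝓝 (ψ 2 * ψ (-1) / (k * c) * ∑ ν ∈ Icc (1 : ℤ) (c * k : ℕ), ∑ j ∈ range k,
        ψ (ν : ZMod k) * ((-1 : ℂ) ^ j * ψ⁻¹ (j : ZMod k)) *
        ((-(2 * Real.pi * Complex.I) ^ m / (m.factorial : ℂ) * (bernoulliPer m (-(ν / (c * k))) : ℂ)) *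
        ((Real.pi * Complex.I) ^ (q + 1) / (2 * (q.factorial : ℂ)) *
          (eulerPer q ((j + 2 * δ * ν / c) / k) : ℂ))))) := by
    refine Tendsto.const_mul _ (tendsto_finsetSum _ fun ν _ => tendsto_finsetSum _ fun j _ => ?_)
    -- Pairs with zero coefficient are set aside first: the Euler expansion may fail there.
    by_cases h : ψ (ν : ZMod k) * ψ⁻¹ (j : ZMod k) = 0
    · have h' : ψ (ν : ZMod k) * ((-1 : ℂ) ^ j * ψ⁻¹ (j : ZMod k)) = 0 := by
        linear_combination (-1 : ℂ) ^ j * h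
      simp only [h', zero_mul]
      exact tendsto_const_nhds
    · refine Tendsto.const_mul _ (Tendsto.mul ?_ ?_)
      · exact (tendsto_sum_Ico_bernoulliPer hm _).comp hT1
      · exact (tendsto_sum_Ico_eulerPer fun _ =>
          fract_ne_zero_of_char_ne_zero hc hdet h0 h).comp hT2
  refine hlim.congr fun T => ?_
  simp only [sum_mul_sum]
  simp only [mul_sum]
  rw [sum_comm_four]
  refine sum_congr rfl fun n _ => sum_congr rfl fun M _ => ?_
  by_cases hM : Odd M
  · have hW := sum_exp_eq_latticeWeight (δ := δ) hk hψ hc n hM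
    have hW' : latticeWeight ψ c δ n M = ψ 2 * ψ (-1) / (k * c) *
        (ψ⁻¹ 2 * ψ (-1) * k * c * latticeWeight ψ c δ n M) := by
      field_simp
      linear_combination (-latticeWeight ψ c δ n M * ψ (-1) ^ 2) * char_two_mul_inv_char_two hk -
        latticeWeight ψ c δ n M * char_neg_one_mul_self ψ
    rw [hW', ← hW, mul_sum, sum_mul]
    refine sum_congr rfl fun ν _ => ?_
    rw [mul_sum, sum_mul]
    refine sum_congr rfl fun j _ => ?_
    rw [if_pos hM]
    ring
  · rw [latticeWeight, if_neg fun h => hM h.1]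
    simp [hM]

end

/-! ### The transformation formula -/

section

variable {k : ℕ} [NeZero k] {ψ χ : DirichletCharacter ℂ k} {c : ℕ} {a b δ : ℤ}

/-- Bookkeeping: the factorials form the binomial coefficient, `2^m` cancels against `U^{m-1}` and
the `1/2` of the Euler expansion, and the parity of `𝔅_m` supplies the sign in `(-(cz + 2δ))^{m-1}`.
-/
theorem sum_pow_mul_dedekindSum_eq_g1 (ψ : DirichletCharacter ℂ k) (c : ℕ) (δ : ℤ) (z : ℂ)
    (p : ℕ) :
    ∑ m ∈ Icc 1 p, ((c * z + 2 * δ) / 2) ^ (m - 1) *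
      (ψ 2 * ψ (-1) / (k * c) * ∑ ν ∈ Icc (1 : ℤ) (c * k : ℕ), ∑ j ∈ range k,
        ψ (ν : ZMod k) * ((-1 : ℂ) ^ j * ψ⁻¹ (j : ZMod k)) *
        ((-(2 * Real.pi * Complex.I) ^ m / (m.factorial : ℂ) * (bernoulliPer m (-(ν / (c * k))) : ℂ)) *
        ((Real.pi * Complex.I) ^ (p - m + 1) / (2 * ((p - m).factorial : ℂ)) *
          (eulerPer (p - m) ((j + 2 * δ * ν / c) / k) : ℂ)))) =
      ψ 2 * ψ (-1) / (k * c) * ((Real.pi * Complex.I) ^ (p + 1) / (p.factorial : ℂ)) *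
        g1 c (2 * δ) z p ψ := by
  have hk0 : (k : ℂ) ≠ 0 := NeZero.ne _
  rw [g1, mul_sum]
  refine sum_congr rfl fun m hm => ?_
  obtain ⟨hm1, hmp⟩ := mem_Icc.1 hm
  obtain ⟨r, rfl⟩ := Nat.exists_eq_add_of_le hmp
  obtain ⟨s, rfl⟩ := Nat.exists_eq_add_of_le' hm1
  have hr : s + 1 + r - (s + 1) = r := by omega
  have hs : s + 1 - 1 = s := by omega
  simp only [hr, hs]
  have hchoose : ((s + 1 + r).choose (s + 1) : ℂ) =
      ((s + 1 + r).factorial : ℂ) / ((s + 1).factorial * r.factorial) := by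
    rw [Nat.cast_add_choose]
  have hzpow : (k : ℂ) ^ (((s + 1 : ℕ) : ℤ) - ((s + 1 + r : ℕ) : ℤ)) = 1 / (k : ℂ) ^ r := by
    rw [show ((s + 1 : ℕ) : ℤ) - ((s + 1 + r : ℕ) : ℤ) = -(r : ℤ) by push_cast; ring, zpow_neg,
      zpow_natCast, one_div]
  have hsum : ∑ ν ∈ Icc (1 : ℤ) ((c : ℤ) * k), ψ (ν : ZMod k) *
        eulerChar r ψ (((2 * δ : ℤ) : ℝ) * (ν : ℝ) / ((c : ℤ) : ℝ)) *
          (bernoulliPer (s + 1) ((ν : ℝ) / (((c : ℤ) : ℝ) * (k : ℝ))) : ℂ) =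
      (k : ℂ) ^ r * ∑ ν ∈ Icc (1 : ℤ) (c * k : ℕ), ∑ j ∈ range k, ψ (ν : ZMod k) *
        ((-1 : ℂ) ^ j * ψ⁻¹ (j : ZMod k)) * ((bernoulliPer (s + 1) (ν / (c * k)) : ℂ) *
          (eulerPer r ((j + 2 * δ * ν / c) / k) : ℂ)) := by
    rw [mul_sum]
    push_cast
    refine sum_congr rfl fun ν _ => ?_
    rw [eulerChar, MulChar.star_eq_inv, mul_sum, mul_sum, mul_sum, sum_mul]
    refine sum_congr rfl fun j _ => ?_
    ring
  rw [hsum, hchoose, hzpow]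
  have f1 : ((s + 1).factorial : ℂ) ≠ 0 := by exact_mod_cast Nat.factorial_ne_zero _
  have f2 : (r.factorial : ℂ) ≠ 0 := by exact_mod_cast Nat.factorial_ne_zero _
  have f3 : ((s + 1 + r).factorial : ℂ) ≠ 0 := by exact_mod_cast Nat.factorial_ne_zero _
  have hinner : ∑ ν ∈ Icc (1 : ℤ) (c * k : ℕ), ∑ j ∈ range k,
        ψ (ν : ZMod k) * ((-1 : ℂ) ^ j * ψ⁻¹ (j : ZMod k)) *
        ((-(2 * Real.pi * Complex.I) ^ (s + 1) / ((s + 1).factorial : ℂ) *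
          (bernoulliPer (s + 1) (-(ν / (c * k))) : ℂ)) *
        ((Real.pi * Complex.I) ^ (r + 1) / (2 * (r.factorial : ℂ)) *
          (eulerPer r ((j + 2 * δ * ν / c) / k) : ℂ))) =
      (2 ^ s * (-1) ^ s * (Real.pi * Complex.I) ^ (s + 1 + r + 1) /
        ((s + 1).factorial * r.factorial)) *
      ∑ ν ∈ Icc (1 : ℤ) (c * k : ℕ), ∑ j ∈ range k, ψ (ν : ZMod k) *
        ((-1 : ℂ) ^ j * ψ⁻¹ (j : ZMod k)) * ((bernoulliPer (s + 1) (ν / (c * k)) : ℂ) *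
          (eulerPer r ((j + 2 * δ * ν / c) / k) : ℂ)) := by
    rw [mul_sum]
    refine sum_congr rfl fun ν _ => ?_
    rw [mul_sum]
    refine sum_congr rfl fun j _ => ?_
    rw [bernoulliPer_neg]
    push_cast
    field_simp
    ring
  rw [hinner]
  clear hinner hsum
  generalize (∑ ν ∈ Icc (1 : ℤ) (c * k : ℕ), ∑ j ∈ range k, ψ (ν : ZMod k) *
        ((-1 : ℂ) ^ j * ψ⁻¹ (j : ZMod k)) * ((bernoulliPer (s + 1) (ν / (c * k)) : ℂ) *
          (eulerPer r ((j + 2 * δ * ν / c) / k) : ℂ))) = S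
  push_cast
  rw [neg_pow ((c : ℂ) * z + 2 * δ), div_pow]
  field_simp

/-- The transformation formula before specializing the congruence conditions. -/
theorem A1_transformation (hk : Odd k) (hχp : χ.IsPrimitive) (hχ : χ ≠ 1) (hψp : ψ.IsPrimitive)
    (hψ : ψ ≠ 1) (hc : 0 < c) (hco : Odd c) (hdet : a * (2 * δ) - b * c = 1) {κ : ℂ}
    (hκ : ∀ n l : ℤ, Odd l → ψ ((2 * a * n + c * l : ℤ) : ZMod k) *
      ψ⁻¹ ((b * n + δ * l : ℤ) : ZMod k) = κ * χ (n : ZMod k) * χ⁻¹ (l : ZMod k))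
    {z : ℂ} (hz : 0 < z.im) {p : ℕ} (hp : Odd p) :
    κ * χ⁻¹ 2 * G χ⁻¹ * (c * z + 2 * δ) ^ (p - 1) *
        A1 ((a * z + b) / (c * z + 2 * δ)) (1 - (p : ℂ)) χ =
      2 ^ p * G ψ⁻¹ * B z (1 - (p : ℂ)) ψ -
        ψ 2 * ψ (-1) / 4 * ((2 * Real.pi * Complex.I) ^ p / (p.factorial : ℂ)) *
          g1 c (2 * δ) z p ψ := by
  have hk0 : (k : ℂ) ≠ 0 := NeZero.ne _
  have hc0 : (c : ℂ) ≠ 0 := by exact_mod_cast hc.ne'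
  have hc1 : (0 : ℝ) < c := by exact_mod_cast hc
  set U : ℂ := (c * z + 2 * δ) / 2 with hU
  have hUim : 0 < U.im := by
    have : U.im = c * z.im / 2 := by rw [hU, Complex.div_ofNat_im]; simp
    rw [this]; positivity
  have hU0 : U ≠ 0 := fun h => by rw [h] at hUim; simp at hUim
  have hV : (c * z + 2 * δ : ℂ) = 2 * U := by rw [hU]; ring
  have hτ : 0 < (-U⁻¹).im := by
    rw [Complex.neg_im, Complex.inv_im, neg_div, neg_neg]
    exact div_pos hUim (Complex.normSq_pos.2 hU0)
  -- The case `n = 0`, `l = 1` of `hκ`, since `χ(0) = 0`.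
  have h0 : ψ (c : ZMod k) * ψ⁻¹ (δ : ZMod k) = 0 := by
    have := hκ 0 1 odd_one
    simpa [char_zero hχ] using this
  have key := pow_mul_tsum_cotSum_eq (Nat.mul_pos hc hk.pos)
    (Nat.mul_pos hc (Nat.mul_pos two_pos hk.pos)) hp.pos hUim.ne' (W := latticeWeight ψ c δ)
    (norm_latticeWeight_le ψ c δ) (fun n M t => latticeWeight_periodic_left hc n M t)
    (fun n M t => latticeWeight_periodic_right hc n M t) (sum_latticeWeight_left hc hψ)
    (sum_latticeWeight_right hk hc hco hdet hχ hκ)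
    (latticeWeight_apply_zero_left hc hco hdet hχ hκ) latticeWeight_apply_zero_right
    (fun m hm => by
      obtain ⟨hm1, hmp⟩ := mem_Icc.1 hm
      have := tendsto_sum_latticeWeight (δ := δ) hk hψp hc hdet h0 hm1 (p - m)
      rw [show p - m + 1 = p + 1 - m by omega] at this
      exact this)
  rw [tsum_cotSum_latticeWeight_right hk hχp hχ hc hco hdet hκ hτ hp,
    tsum_cotSum_latticeWeight_left hψp hψ hc hz hp] at key
  have hg := sum_pow_mul_dedekindSum_eq_g1 ψ c δ z p
  have hexp : ∀ m ∈ Icc 1 p, p + 1 - m = p - m + 1 := fun m hm => by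
    have := (mem_Icc.1 hm).2; omega
  rw [sum_congr rfl fun m hm => by rw [hexp m hm], hg] at key
  have hR : (2 * a + -U⁻¹) / (2 * c) = (a * z + b) / (c * z + 2 * δ) := by
    rw [hV]
    have hdet' : (a : ℂ) * (2 * δ) - b * c = 1 := by exact_mod_cast hdet
    field_simp
    linear_combination (a : ℂ) * hU * 2 + hdet'
  rw [hR] at key
  obtain ⟨s, rfl⟩ : ∃ s, p = s + 1 := ⟨p - 1, by have := hp.pos; omega⟩
  set X := A1 ((a * z + b) / (c * z + 2 * δ)) (1 - ((s + 1 : ℕ) : ℂ)) χ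
  set Y := B z (1 - ((s + 1 : ℕ) : ℂ)) ψ
  set Z := g1 c (2 * δ) z (s + 1) ψ
  clear_value X Y Z U
  rw [hV, Nat.add_sub_cancel]
  have hUp : U ^ (s + 1) * U⁻¹ = U ^ s := by rw [pow_succ, mul_assoc, mul_inv_cancel₀ hU0, mul_one]
  have hne : -(2 * Real.pi * Complex.I) / (k * c) ≠ 0 :=
    div_ne_zero (neg_ne_zero.2 Complex.two_pi_I_ne_zero) (mul_ne_zero hk0 hc0)
  apply mul_left_cancel₀ hne
  -- The factor `2 ^ s` with `s = p - 1` converts `U ^ s` into `(cz + 2δ) ^ s`.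
  linear_combination 2 ^ s * key - 2 ^ s * (κ * χ⁻¹ 2 / c *
    (-(2 * Real.pi * Complex.I) / k * G χ⁻¹ * X)) * hUp

end

/-! ### The shift by `ck` in `g1`, and specialization to the two congruence cases. -/

theorem eulerChar_add_mul_intCast {k : ℕ} [NeZero k] (m : ℕ) (ψ : DirichletCharacter ℂ k) (x : ℝ)
    (n : ℤ) : eulerChar m ψ (x + k * n) = (-1) ^ n * eulerChar m ψ x := by
  have hk0 : (k : ℝ) ≠ 0 := NeZero.ne _
  rw [eulerChar, eulerChar, mul_left_comm]
  congr 1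
  rw [mul_sum]
  refine sum_congr rfl fun j _ => ?_
  rw [show ((j : ℝ) + (x + k * n)) / k = (j + x) / k + n by field_simp; ring, eulerPer_add_intCast]
  push_cast
  ring

theorem g1_add_mul {k : ℕ} [NeZero k] {c : ℤ} (hc : 0 < c) (d : ℤ) (z : ℂ) (p : ℕ)
    (ψ : DirichletCharacter ℂ k) :
    g1 c (d + c * (k : ℤ)) z p ψ =
      ∑ m ∈ Icc 1 p,
        (p.choose m : ℂ) * (k : ℂ) ^ ((m : ℤ) - (p : ℤ)) *
          (-((c : ℂ) * z + (d : ℂ) + (c : ℂ) * (k : ℂ))) ^ (m - 1) *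
          ∑ n ∈ Icc (1 : ℤ) (c * (k : ℤ)),
            (-1 : ℂ) ^ n * ψ (n : ZMod k) * eulerChar (p - m) ψ ((d : ℝ) * (n : ℝ) / (c : ℝ)) *
              (bernoulliPer m ((n : ℝ) / ((c : ℝ) * (k : ℝ))) : ℂ) := by
  have hc0 : (c : ℝ) ≠ 0 := by exact_mod_cast hc.ne'
  rw [g1]
  refine sum_congr rfl fun m _ => ?_
  congr 1
  · push_cast
    rw [add_assoc]
  · refine sum_congr rfl fun n _ => ?_
    rw [show ((d + c * (k : ℤ) : ℤ) : ℝ) * n / c = d * n / c + k * n by push_cast; field_simp,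
      eulerChar_add_mul_intCast]
    ring

theorem H1_one_sub_natCast {k p : ℕ} (hp : Odd p) (z : ℂ) (χ : DirichletCharacter ℂ k) :
    H1 z (1 - (p : ℂ)) χ = 2 * A1 z (1 - (p : ℂ)) χ ∧
      B1 z (1 - (p : ℂ)) χ = 2 * B z (1 - (p : ℂ)) χ := by
  obtain ⟨s, rfl⟩ := hp
  have : Complex.exp (Real.pi * Complex.I * (1 - ((2 * s + 1 : ℕ) : ℂ))) = 1 := by
    rw [Complex.exp_eq_one_iff]
    exact ⟨-s, by push_cast; ring⟩
  rw [H1, B1, this, one_add_one_eq_two]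
  exact ⟨rfl, rfl⟩

theorem inv_char_mul_char {k : ℕ} (χ : DirichletCharacter ℂ k) {x : ZMod k} (hx : IsUnit x) :
    χ⁻¹ x * χ x = 1 := by
  rw [← MulChar.mul_apply, inv_mul_cancel, MulChar.one_apply hx]

theorem intCast_eq_zero_of_dvd {k : ℕ} {n : ℤ} (h : (k : ℤ) ∣ n) : (n : ZMod k) = 0 :=
  (ZMod.intCast_zmod_eq_zero_iff_dvd _ _).2 h

end CharLogTheta

open CharLogTheta in
theorem theoremc5 (k : ℕ) [NeZero k] (hk : Odd k)
    (χ : DirichletCharacter ℂ k) (hprim : χ.IsPrimitive) (hχ : χ ≠ 1)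
    (p : ℕ) (hp : Odd p)
    (a b c d : ℤ) (hdet : a * d - b * c = 1) (hc : 0 < c) (hcodd : Odd c) (hdodd : Odd d) :
    -- the explicit form of `g_1` at `d + ck`, for `χ` and for its conjugate
    (∀ ψ ∈ ({χ, star χ} : Set (DirichletCharacter ℂ k)), ∀ z : ℂ,
      CharLogTheta.g1 c (d + c * (k : ℤ)) z p ψ =
        ∑ m ∈ Finset.Icc 1 p,
          (p.choose m : ℂ) * (k : ℂ) ^ ((m : ℤ) - (p : ℤ)) *
            (-((c : ℂ) * z + (d : ℂ) + (c : ℂ) * (k : ℂ))) ^ (m - 1) *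
            ∑ n ∈ Finset.Icc (1 : ℤ) (c * (k : ℤ)),
              (-1 : ℂ) ^ n * ψ (n : ZMod k) *
                CharLogTheta.eulerChar (p - m) ψ ((d : ℝ) * (n : ℝ) / (c : ℝ)) *
                (CharLogTheta.bernoulliPer m ((n : ℝ) / ((c : ℝ) * (k : ℝ))) : ℂ)) ∧
    ((k : ℤ) ∣ a → (k : ℤ) ∣ d → ∀ z : ℂ, 0 < z.im →
      CharLogTheta.G (star χ) * ((c : ℂ) * z + (d : ℂ) + (c : ℂ) * (k : ℂ)) ^ (p - 1) *
          CharLogTheta.H1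
            (((a : ℂ) * z + (b : ℂ) + (a : ℂ) * (k : ℂ)) /
              ((c : ℂ) * z + (d : ℂ) + (c : ℂ) * (k : ℂ))) (1 - (p : ℂ)) χ =
        (star χ) (b : ZMod k) * χ (c : ZMod k) * CharLogTheta.G χ * 2 ^ p * χ (2 : ZMod k) *
            CharLogTheta.B1 z (1 - (p : ℂ)) (star χ) -
          (star χ) (b : ZMod k) * χ ((-c : ℤ) : ZMod k) / 2 *
            ((2 * (Real.pi : ℂ) * Complex.I) ^ p / (p.factorial : ℂ)) *
            CharLogTheta.g1 c (d + c * (k : ℤ)) z p (star χ)) ∧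
    ((k : ℤ) ∣ b → (k : ℤ) ∣ c → ∀ z : ℂ, 0 < z.im →
      CharLogTheta.G (star χ) * ((c : ℂ) * z + (d : ℂ) + (c : ℂ) * (k : ℂ)) ^ (p - 1) *
          CharLogTheta.H1
            (((a : ℂ) * z + (b : ℂ) + (a : ℂ) * (k : ℂ)) /
              ((c : ℂ) * z + (d : ℂ) + (c : ℂ) * (k : ℂ))) (1 - (p : ℂ)) χ =
        (star χ) (a : ZMod k) * χ (d : ZMod k) * CharLogTheta.G (star χ) * 2 ^ p *
            (star χ) (2 : ZMod k) * CharLogTheta.B1 z (1 - (p : ℂ)) χ -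
          (star χ) (a : ZMod k) * χ ((-d : ℤ) : ZMod k) / 2 *
            ((2 * (Real.pi : ℂ) * Complex.I) ^ p / (p.factorial : ℂ)) *
            CharLogTheta.g1 c (d + c * (k : ℤ)) z p χ) := by
  refine ⟨fun ψ _ z => g1_add_mul hc d z p ψ, ?_⟩
  rw [MulChar.star_eq_inv]
  lift c to ℕ using hc.le
  have hc' : 0 < c := by exact_mod_cast hc
  have hco : Odd c := by exact_mod_cast hcodd
  -- As `c`, `d`, `k` are odd, `d + ck` is even. Replacing `(b, d)` by `(b + ak, d + ck)` preserves
  -- the determinant.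
  obtain ⟨δ, hδ⟩ := hdodd.add_odd (hcodd.mul (show Odd (k : ℤ) by exact_mod_cast hk))
  have hδ' : d + c * (k : ℤ) = 2 * δ := by linarith
  have hdet' : a * (2 * δ) - (b + a * k) * c = 1 := by rw [← hδ']; linear_combination hdet
  have hδC : (d : ℂ) = 2 * δ - c * k := by
    have : d = 2 * δ - c * k := by linarith
    rw [this]; push_cast; ring
  have hdδ : (d : ZMod k) = 2 * δ := by
    have := congrArg (Int.cast : ℤ → ZMod k) hδ'
    push_cast at this
    rwa [ZMod.natCast_self, mul_zero, add_zero] at this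
  have hu2 : IsUnit (2 : ZMod k) := by
    have := (ZMod.isUnit_iff_coprime 2 k).2 (Nat.coprime_two_left.2 hk)
    simpa using this
  have hdetZ : (a : ZMod k) * d - b * c = 1 := by exact_mod_cast congrArg (Int.cast : ℤ → ZMod k) hdet
  have hχi := isPrimitive_inv hprim
  have hχi1 : χ⁻¹ ≠ 1 := inv_ne_one.2 hχ
  have hden : ∀ z : ℂ, ((c : ℤ) : ℂ) * z + d + ((c : ℤ) : ℂ) * k = c * z + 2 * δ := fun z => by
    rw [hδC]; push_cast; ring
  have hnum : ∀ z : ℂ, (a : ℂ) * z + b + a * k = a * z + ((b + a * k : ℤ) : ℂ) := fun z => by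
    push_cast; ring
  refine ⟨fun hka hkd z hz => ?_, fun hkb hkc z hz => ?_⟩
  · have ha0 := intCast_eq_zero_of_dvd hka
    have hd0 := intCast_eq_zero_of_dvd hkd
    have hδ0 : (δ : ZMod k) = 0 := by
      rw [hd0] at hdδ
      exact (hu2.mul_right_eq_zero).1 hdδ.symm
    have hub : IsUnit (b : ZMod k) := IsUnit.of_mul_eq_one (-(c : ZMod k)) (by
      rw [ha0] at hdetZ; linear_combination hdetZ)
    have huc : IsUnit (c : ZMod k) := IsUnit.of_mul_eq_one (-(b : ZMod k)) (by
      rw [ha0] at hdetZ; linear_combination hdetZ)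
    -- Modulo `k`, `a` and `δ` vanish, so `M ≡ cl` and `N ≡ bn`: the roles of `n` and `l` are
    -- swapped, which calls for `ψ = χ̄`.
    have h := A1_transformation (ψ := χ⁻¹) (κ := χ⁻¹ (c : ZMod k) * χ (b : ZMod k)) hk hprim hχ hχi
      hχi1 hc' hco hdet' (fun n l _ => by
        push_cast
        rw [ha0, hδ0, inv_inv]
        simp only [mul_zero, zero_mul, zero_add, add_zero, map_mul]
        ring) hz hp
    rw [inv_inv, inv_char_neg_one] at h
    rw [hden, hnum, (H1_one_sub_natCast hp _ _).1, (H1_one_sub_natCast hp _ _).2, hδ',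
      char_intCast_neg, Int.cast_natCast]
    have e1 := inv_char_mul_char χ hub
    have e2 := inv_char_mul_char χ huc
    have e3 := inv_char_mul_char χ hu2
    set T := 2 * (G χ⁻¹ * (c * z + 2 * δ) ^ (p - 1) *
      A1 ((a * z + ((b + a * k : ℤ) : ℂ)) / (c * z + 2 * δ)) (1 - (p : ℂ)) χ) with hT
    set S := χ⁻¹ (b : ZMod k) * (χ (-1) * χ (c : ZMod k)) / 2 *
      ((2 * (Real.pi : ℂ) * Complex.I) ^ p / (p.factorial : ℂ)) * g1 c (2 * δ) z p χ⁻¹ with hS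
    linear_combination (2 * χ⁻¹ (b : ZMod k) * χ (c : ZMod k) * χ 2) * h - T * ((χ⁻¹ (c : ZMod k) * χ (c : ZMod k)) * (χ⁻¹ 2 * χ 2) * e1 +
      (χ⁻¹ 2 * χ 2) * e2 + e3) - S * e3
  · have hb0 := intCast_eq_zero_of_dvd hkb
    have hc0 := intCast_eq_zero_of_dvd hkc
    rw [Int.cast_natCast] at hc0
    have hua : IsUnit (a : ZMod k) := IsUnit.of_mul_eq_one (d : ZMod k) (by
      rw [hb0] at hdetZ; linear_combination hdetZ)
    have hud : IsUnit (d : ZMod k) := IsUnit.of_mul_eq_one (a : ZMod k) (by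
      rw [hb0] at hdetZ; linear_combination hdetZ)
    have e1 := inv_char_mul_char χ hua
    have e2 := inv_char_mul_char χ hud
    have e3 := inv_char_mul_char χ hu2
    have e4 : χ⁻¹ (δ : ZMod k) = χ 2 * χ⁻¹ (d : ZMod k) := by
      rw [hdδ, map_mul]
      linear_combination (-χ⁻¹ (δ : ZMod k)) * e3
    -- Now `M ≡ 2an` and `N ≡ δl` modulo `k`. One factor `χ(2)` comes from `2a`, the other from
    -- `χ̄(δ) = χ(2) χ̄(d)`.
    have h := A1_transformation (ψ := χ) (κ := χ 2 ^ 2 * χ (a : ZMod k) * χ⁻¹ (d : ZMod k)) hk hprim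
      hχ hprim hχ hc' hco hdet' (fun n l _ => by
        push_cast
        rw [hc0, hb0, ZMod.natCast_self]
        simp only [mul_zero, zero_mul, zero_add, add_zero, map_mul]
        rw [e4]
        ring) hz hp
    rw [hden, hnum, (H1_one_sub_natCast hp _ _).1, (H1_one_sub_natCast hp _ _).2, hδ',
      char_intCast_neg]
    set T := 2 * (G χ⁻¹ * (c * z + 2 * δ) ^ (p - 1) *
      A1 ((a * z + ((b + a * k : ℤ) : ℂ)) / (c * z + 2 * δ)) (1 - (p : ℂ)) χ) with hT
    set S := χ⁻¹ (a : ZMod k) * (χ (-1) * χ (d : ZMod k)) / 2 *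
      ((2 * (Real.pi : ℂ) * Complex.I) ^ p / (p.factorial : ℂ)) * g1 c (2 * δ) z p χ with hS
    linear_combination (2 * χ⁻¹ (a : ZMod k) * χ (d : ZMod k) * χ⁻¹ 2) * h - T * ((χ⁻¹ (d : ZMod k) * χ (d : ZMod k)) * (χ⁻¹ 2 * χ 2) ^ 2 * e1 +
      (χ⁻¹ 2 * χ 2) ^ 2 * e2 + (χ⁻¹ 2 * χ 2 + 1) * e3) - S * e3
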